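/- **Theorem (companions and conjoints of natural transformations).** Let $\mathbb{D}$ and $\mathbb{E}$ be (pseudo) double categories, let $F, G : \mathbb{D} \to \mathbb{E}$ be lax double functors, and let $\alpha : F \Rightarrow G$ be a (strict) natural transformation, with components the arrows $\alpha_x : Fx \to Gx$ for objects $x$ and the cells $\alpha_m : Fm \to Gm$ for proarrows $m$ of $\mathbb{D}$. 1. $\alpha$ has a companion in the double category $\mathrm{Lax}_{\mathrm{oplax}}(\mathbb{D},\mathbb{E})$, which is an oplax protransformation $\alpha_! : F \nrightarrow G$, if and only if for every object $x$ of $\mathbb{D}$ the arrow $\alpha_x : Fx \to Gx$ has a companion in $\mathbb{E}$. 2. $\alpha$ has a conjoint in the double category $\mathrm{Lax}_{\mathrm{lax}}(\mathbb{D},\mathbb{E})$, which is a lax protransformation $\alpha^* : G \nrightarrow F$, if and only if for every object $x$ of $\mathbb{D}$ the arrow $\alpha_x : Fx \to Gx$ has a conjoint in $\mathbb{E}$. *Definitions.* Arrows and cells compose strictly in the direction of arrows (written $\cdot$); proarrows $m : x \nrightarrow y$ and cells compose up to coherent globular isomorphism in the direction of proarrows (written $\odot$, in diagrammatic order), with units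 $\mathrm{id}_x$, $\mathrm{id}_f$. A cell is globular if its two bounding arrows are identities. A *companion* of an arrow $f : x \to y$ is a proarrow $f_! : x \nrightarrow y$ with cells $\eta : \mathrm{id}_x \to f_!$, bounded on the left by $1_x$ and on the right by $f$, and $\varepsilon : f_! \to \mathrm{id}_y$, bounded on the left by $f$ and on the right by $1_y$, such that $\eta \odot \varepsilon = 1_{f_!}$ (modulo the unit isomorphisms $\mathrm{id}_x \odot f_! \cong f_! \cong f_! \odot \mathrm{id}_y$) and $\eta \cdot \varepsilon = \mathrm{id}_f$. A *conjoint* of $f$ is a proarrow $f^* : y \nrightarrow x$ with cells $\eta : \mathrm{id}_x \to f^*$, bounded by $f$ and $1_x$, and $\varepsilon : f^* \to \mathrm{id}_y$, bounded by $1_y$ and $f$, such that $\varepsilon \odot \eta = 1_{f^*}$ (modulo unit isomorphisms) and $\eta \cdot \varepsilon = \mathrm{id}_f$. A *lax protransformation* $\tau : F \nrightarrow G$ consists of proarrows $\tau_x : Fx \nrightarrow Gx$ for objects $x$, cells $\tau_f : \tau_x \to \tau_y$ bounded by $Ff$ and $Gf$ for arrows $f : x \to y$, functorial in $f$, and globular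 cells $\tau_m : \tau_x \odot Gm \to Fm \odot \tau_y$ for proarrows $m : x \nrightarrow y$, such that $\tau_m \cdot (F\gamma \odot \tau_g) = (\tau_f \odot G\gamma) \cdot \tau_n$ for every cell $\gamma : m \to n$ bounded by $f$ and $g$, and such that the $\tau_m$ are compatible with the laxity cells $F_{m,n}, G_{m,n}$ and $F_x, G_x$ of $F$ and $G$: modulo associators and unitors, $$(\tau_m \odot 1_{Gn}) \cdot (1_{Fm} \odot \tau_n) \cdot (F_{m,n} \odot 1_{\tau_z}) = (1_{\tau_x} \odot G_{m,n}) \cdot \tau_{m \odot n}, \qquad (1_{\tau_x} \odot G_x) \cdot \tau_{\mathrm{id}_x} = F_x \odot 1_{\tau_x}$$ for all proarrows $m : x \nrightarrow y$, $n : y \nrightarrow z$ and all objects $x$. An *oplax protransformation* is the same, except that its comparison cells are globular cells $\tau_m : Fm \odot \tau_y \to \tau_x \odot Gm$, with the axioms on them changed accordingly. The double categories $\mathrm{Lax}_{\mathrm{lax}}(\mathbb{D},\mathbb{E})$ and $\mathrm{Lax}_{\mathrm{oplax}}(\mathbb{D},\mathbb{E})$ have as objects the lax double functors $\mathbb{D}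 \to \mathbb{E}$, as arrows the natural transformations, as proarrows the lax, respectively oplax, protransformations, composed componentwise with comparison cells pasted, and as cells the *modifications*: a modification $\mu$ from $\sigma : F \nrightarrow G$ to $\tau : H \nrightarrow K$, bounded by natural transformations $\alpha : F \Rightarrow H$ and $\beta : G \Rightarrow K$, consists of cells $\mu_x : \sigma_x \to \tau_x$ bounded by $\alpha_x$ and $\beta_x$, for all objects $x$, such that $\mu_x \cdot \tau_f = \sigma_f \cdot \mu_y$ for all arrows $f : x \to y$ and, for all proarrows $m : x \nrightarrow y$, $(\mu_x \odot \beta_m) \cdot \tau_m = \sigma_m \cdot (\alpha_m \odot \mu_y)$ in the lax case, and $\sigma_m \cdot (\mu_x \odot \beta_m) = (\alpha_m \odot \mu_y) \cdot \tau_m$ in the oplax case. Modifications compose componentwise, and the associators and unitors are those of $\mathbb{E}$, componentwise. -/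

import Mathlib

open CategoryTheory

universe u v w r u₁ v₁ w₁ r₁ u₂ v₂ w₂ r₂

namespace Dbl

/-- A (pseudo) double category: a pseudocategory internal to categories. Objects and arrows form
a category; the proarrows together with all cells between them form a second category, on which
`src` and `tgt` are the source and target functors. A cell `γ : Cell m n` is a square with top
`m`, bottom `n`, left side `src γ` and right side `tgt γ`. Cells compose strictly in the direction
of the arrows (`comp`), and up to coherent globular isomorphism in the direction of the proarrows
(`hcomp`). -/
structure DoubleCategory where
  Obj : Type u
  [cat : Category.{v} Obj]
  Pro : Obj → Obj → Type w
  Cell : ∀ {x y x' y' : Obj}, Pro x y → Pro x' y' → Type r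
  src : ∀ {x y x' y' : Obj} {m : Pro x y} {n : Pro x' y'}, Cell m n → (x ⟶ x')
  tgt : ∀ {x y x' y' : Obj} {m : Pro x y} {n : Pro x' y'}, Cell m n → (y ⟶ y')
  /-- The identity cell `1_m` on a proarrow. -/
  one : ∀ {x y : Obj} (m : Pro x y), Cell m m
  /-- Internal composition of cells, along proarrows. -/
  comp : ∀ {x y x' y' x'' y'' : Obj} {m : Pro x y} {n : Pro x' y'} {p : Pro x'' y''},
    Cell m n → Cell n p → Cell m p
  src_one : ∀ {x y : Obj} (m : Pro x y), src (one m) = 𝟙 x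
  tgt_one : ∀ {x y : Obj} (m : Pro x y), tgt (one m) = 𝟙 y
  src_comp : ∀ {x y x' y' x'' y'' : Obj} {m : Pro x y} {n : Pro x' y'} {p : Pro x'' y''}
    (γ : Cell m n) (δ : Cell n p), src (comp γ δ) = src γ ≫ src δ
  tgt_comp : ∀ {x y x' y' x'' y'' : Obj} {m : Pro x y} {n : Pro x' y'} {p : Pro x'' y''}
    (γ : Cell m n) (δ : Cell n p), tgt (comp γ δ) = tgt γ ≫ tgt δ
  one_comp : ∀ {x y x' y' : Obj} {m : Pro x y} {n : Pro x' y'} (γ : Cell m n),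
    comp (one m) γ = γ
  comp_one : ∀ {x y x' y' : Obj} {m : Pro x y} {n : Pro x' y'} (γ : Cell m n),
    comp γ (one n) = γ
  comp_assoc : ∀ {x y x' y' x'' y'' x₃ y₃ : Obj} {m : Pro x y} {n : Pro x' y'}
    {p : Pro x'' y''} {q : Pro x₃ y₃} (γ : Cell m n) (δ : Cell n p) (ε : Cell p q),
    comp (comp γ δ) ε = comp γ (comp δ ε)
  /-- The identity proarrow `id_x`. -/
  idPro : ∀ x : Obj, Pro x x
  /-- The external identity cell `id_f`. -/
  idCell : ∀ {x y : Obj} (_ : x ⟶ y), Cell (idPro x) (idPro y)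
  src_idCell : ∀ {x y : Obj} (f : x ⟶ y), src (idCell f) = f
  tgt_idCell : ∀ {x y : Obj} (f : x ⟶ y), tgt (idCell f) = f
  idCell_id : ∀ x : Obj, idCell (𝟙 x) = one (idPro x)
  idCell_comp : ∀ {x y z : Obj} (f : x ⟶ y) (g : y ⟶ z),
    idCell (f ≫ g) = comp (idCell f) (idCell g)
  /-- The composite `m ⊙ n` of proarrows, in diagrammatic order. -/
  pcomp : ∀ {x y z : Obj}, Pro x y → Pro y z → Pro x z
  /-- External composition of cells that share a side. -/
  hcomp : ∀ {x y z x' y' z' : Obj} {m : Pro x y} {n : Pro y z} {m' : Pro x' y'} {n' : Pro y' z'}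
    (γ : Cell m m') (δ : Cell n n'), tgt γ = src δ → Cell (pcomp m n) (pcomp m' n')
  src_hcomp : ∀ {x y z x' y' z' : Obj} {m : Pro x y} {n : Pro y z} {m' : Pro x' y'}
    {n' : Pro y' z'} (γ : Cell m m') (δ : Cell n n') (h : tgt γ = src δ),
    src (hcomp γ δ h) = src γ
  tgt_hcomp : ∀ {x y z x' y' z' : Obj} {m : Pro x y} {n : Pro y z} {m' : Pro x' y'}
    {n' : Pro y' z'} (γ : Cell m m') (δ : Cell n n') (h : tgt γ = src δ),
    tgt (hcomp γ δ h) = tgt δ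
  hcomp_one : ∀ {x y z : Obj} (m : Pro x y) (n : Pro y z),
    hcomp (one m) (one n) ((tgt_one m).trans (src_one n).symm) = one (pcomp m n)
  interchange : ∀ {x y z x' y' z' x'' y'' z'' : Obj} {m : Pro x y} {n : Pro y z}
    {m' : Pro x' y'} {n' : Pro y' z'} {m'' : Pro x'' y''} {n'' : Pro y'' z''}
    (γ : Cell m m') (γ' : Cell m' m'') (δ : Cell n n') (δ' : Cell n' n'')
    (h : tgt γ = src δ) (h' : tgt γ' = src δ'),
    hcomp (comp γ γ') (comp δ δ') (by rw [tgt_comp, src_comp, h, h']) =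
      comp (hcomp γ δ h) (hcomp γ' δ' h')
  -- The associators: globular invertible cells, natural with respect to all cells.
  assocHom : ∀ {x y z t : Obj} (m : Pro x y) (n : Pro y z) (p : Pro z t),
    Cell (pcomp (pcomp m n) p) (pcomp m (pcomp n p))
  assocInv : ∀ {x y z t : Obj} (m : Pro x y) (n : Pro y z) (p : Pro z t),
    Cell (pcomp m (pcomp n p)) (pcomp (pcomp m n) p)
  assoc_hom_inv : ∀ {x y z t : Obj} (m : Pro x y) (n : Pro y z) (p : Pro z t),
    comp (assocHom m n p) (assocInv m n p) = one _
  assoc_inv_hom : ∀ {x y z t : Obj} (m : Pro x y) (n : Pro y z) (p : Pro z t),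
    comp (assocInv m n p) (assocHom m n p) = one _
  src_assocHom : ∀ {x y z t : Obj} (m : Pro x y) (n : Pro y z) (p : Pro z t),
    src (assocHom m n p) = 𝟙 x
  tgt_assocHom : ∀ {x y z t : Obj} (m : Pro x y) (n : Pro y z) (p : Pro z t),
    tgt (assocHom m n p) = 𝟙 t
  assoc_naturality : ∀ {x y z t x' y' z' t' : Obj} {m : Pro x y} {n : Pro y z} {p : Pro z t}
    {m' : Pro x' y'} {n' : Pro y' z'} {p' : Pro z' t'}
    (γ : Cell m m') (δ : Cell n n') (ε : Cell p p') (h : tgt γ = src δ) (h' : tgt δ = src ε),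
    comp (hcomp (hcomp γ δ h) ε ((tgt_hcomp γ δ h).trans h')) (assocHom m' n' p') =
      comp (assocHom m n p) (hcomp γ (hcomp δ ε h') (h.trans (src_hcomp δ ε h').symm))
  -- The left unitors `id_x ⊙ m ≅ m`.
  leftHom : ∀ {x y : Obj} (m : Pro x y), Cell (pcomp (idPro x) m) m
  leftInv : ∀ {x y : Obj} (m : Pro x y), Cell m (pcomp (idPro x) m)
  left_hom_inv : ∀ {x y : Obj} (m : Pro x y), comp (leftHom m) (leftInv m) = one _
  left_inv_hom : ∀ {x y : Obj} (m : Pro x y), comp (leftInv m) (leftHom m) = one _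
  src_leftHom : ∀ {x y : Obj} (m : Pro x y), src (leftHom m) = 𝟙 x
  tgt_leftHom : ∀ {x y : Obj} (m : Pro x y), tgt (leftHom m) = 𝟙 y
  left_naturality : ∀ {x y x' y' : Obj} {m : Pro x y} {m' : Pro x' y'} (f : x ⟶ x')
    (γ : Cell m m') (h : tgt (idCell f) = src γ),
    comp (hcomp (idCell f) γ h) (leftHom m') = comp (leftHom m) γ
  -- The right unitors `m ⊙ id_y ≅ m`.
  rightHom : ∀ {x y : Obj} (m : Pro x y), Cell (pcomp m (idPro y)) m
  rightInv : ∀ {x y : Obj} (m : Pro x y), Cell m (pcomp m (idPro y))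
  right_hom_inv : ∀ {x y : Obj} (m : Pro x y), comp (rightHom m) (rightInv m) = one _
  right_inv_hom : ∀ {x y : Obj} (m : Pro x y), comp (rightInv m) (rightHom m) = one _
  src_rightHom : ∀ {x y : Obj} (m : Pro x y), src (rightHom m) = 𝟙 x
  tgt_rightHom : ∀ {x y : Obj} (m : Pro x y), tgt (rightHom m) = 𝟙 y
  right_naturality : ∀ {x y x' y' : Obj} {m : Pro x y} {m' : Pro x' y'} (f : y ⟶ y')
    (γ : Cell m m') (h : tgt γ = src (idCell f)),
    comp (hcomp γ (idCell f) h) (rightHom m') = comp (rightHom m) γ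
  pentagon : ∀ {x y z t s : Obj} (m : Pro x y) (n : Pro y z) (p : Pro z t) (q : Pro t s),
    comp (hcomp (assocHom m n p) (one q) ((tgt_assocHom m n p).trans (src_one q).symm))
      (comp (assocHom m (pcomp n p) q)
        (hcomp (one m) (assocHom n p q) ((tgt_one m).trans (src_assocHom n p q).symm))) =
      comp (assocHom (pcomp m n) p q) (assocHom m n (pcomp p q))
  triangle : ∀ {x y z : Obj} (m : Pro x y) (n : Pro y z),
    comp (assocHom m (idPro y) n)
      (hcomp (one m) (leftHom n) ((tgt_one m).trans (src_leftHom n).symm)) =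
      hcomp (rightHom m) (one n) ((tgt_rightHom m).trans (src_one n).symm)

attribute [instance] DoubleCategory.cat
attribute [simp] DoubleCategory.src_one DoubleCategory.tgt_one DoubleCategory.src_comp
  DoubleCategory.tgt_comp DoubleCategory.one_comp DoubleCategory.comp_one
  DoubleCategory.src_idCell DoubleCategory.tgt_idCell DoubleCategory.idCell_id
  DoubleCategory.src_hcomp DoubleCategory.tgt_hcomp DoubleCategory.hcomp_one
  DoubleCategory.assoc_hom_inv DoubleCategory.assoc_inv_hom
  DoubleCategory.src_assocHom DoubleCategory.tgt_assocHom
  DoubleCategory.left_hom_inv DoubleCategory.left_inv_hom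
  DoubleCategory.src_leftHom DoubleCategory.tgt_leftHom
  DoubleCategory.right_hom_inv DoubleCategory.right_inv_hom
  DoubleCategory.src_rightHom DoubleCategory.tgt_rightHom

/-- Internal composition of cells. -/
infixr:80 " ≫ᵥ " => DoubleCategory.comp _

/-- Composition of proarrows. -/
infixr:81 " ⊙ₚ " => DoubleCategory.pcomp _

namespace DoubleCategory

section Companions

variable (E : DoubleCategory.{u, v, w, r})

/-- The data exhibiting the proarrow `p : x ⇸ y` as a companion of the arrow `f : x ⟶ y`. -/
structure CompanionPair {x y : E.Obj} (f : x ⟶ y) (p : E.Pro x y) where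
  unit : E.Cell (E.idPro x) p
  src_unit : E.src unit = 𝟙 x
  tgt_unit : E.tgt unit = f
  counit : E.Cell p (E.idPro y)
  src_counit : E.src counit = f
  tgt_counit : E.tgt counit = 𝟙 y
  /-- `η ⊙ ε = 1`, with the unit isomorphisms `p ≅ id_x ⊙ p` and `p ⊙ id_y ≅ p` inserted. -/
  unit_hcomp_counit :
    E.leftInv p ≫ᵥ E.hcomp unit counit (tgt_unit.trans src_counit.symm) ≫ᵥ E.rightHom p = E.one p
  /-- `η ⬝ ε = id_f`. -/
  unit_comp_counit : unit ≫ᵥ counit = E.idCell f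

/-- The data exhibiting the proarrow `p : y ⇸ x` as a conjoint of the arrow `f : x ⟶ y`. -/
structure ConjointPair {x y : E.Obj} (f : x ⟶ y) (p : E.Pro y x) where
  unit : E.Cell (E.idPro x) p
  src_unit : E.src unit = f
  tgt_unit : E.tgt unit = 𝟙 x
  counit : E.Cell p (E.idPro y)
  src_counit : E.src counit = 𝟙 y
  tgt_counit : E.tgt counit = f
  /-- `ε ⊙ η = 1`, with the unit isomorphisms `p ≅ p ⊙ id_x` and `id_y ⊙ p ≅ p` inserted. -/
  counit_hcomp_unit :
    E.rightInv p ≫ᵥ E.hcomp counit unit (tgt_counit.trans src_unit.symm) ≫ᵥ E.leftHom p = E.one p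
  /-- `η ⬝ ε = id_f`. -/
  unit_comp_counit : unit ≫ᵥ counit = E.idCell f

/-- The arrow `f : x ⟶ y` has a companion. -/
def HasCompanion {x y : E.Obj} (f : x ⟶ y) : Prop :=
  ∃ p : E.Pro x y, Nonempty (E.CompanionPair f p)

/-- The arrow `f : x ⟶ y` has a conjoint. -/
def HasConjoint {x y : E.Obj} (f : x ⟶ y) : Prop :=
  ∃ p : E.Pro y x, Nonempty (E.ConjointPair f p)

end Companions

section Globular

variable {E : DoubleCategory.{u, v, w, r}}

/-- Globular cells: both sides are identities. -/
@[ext]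
structure Glob {x y : E.Obj} (m n : E.Pro x y) where
  cell : E.Cell m n
  src_cell : E.src cell = 𝟙 x
  tgt_cell : E.tgt cell = 𝟙 y

attribute [simp] Glob.src_cell Glob.tgt_cell

/-- Proarrows `x ⇸ y` and globular cells form a category. -/
instance proCategory (x y : E.Obj) : Category (E.Pro x y) where
  Hom m n := Glob m n
  id m := ⟨E.one m, by simp, by simp⟩
  comp γ δ := ⟨γ.cell ≫ᵥ δ.cell, by simp, by simp⟩
  id_comp γ := Glob.ext (E.one_comp _)
  comp_id γ := Glob.ext (E.comp_one _)
  assoc γ δ ε := Glob.ext (E.comp_assoc _ _ _)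

/-- The cell underlying a globular cell. -/
def gcell {x y : E.Obj} {m n : E.Pro x y} (γ : m ⟶ n) : E.Cell m n := Glob.cell γ

/-- Make a globular cell. -/
def glob {x y : E.Obj} {m n : E.Pro x y} (γ : E.Cell m n) (hs : E.src γ = 𝟙 x)
    (ht : E.tgt γ = 𝟙 y) : m ⟶ n := Glob.mk γ hs ht

@[simp] theorem src_gcell {x y : E.Obj} {m n : E.Pro x y} (γ : m ⟶ n) :
    E.src (gcell γ) = 𝟙 x := Glob.src_cell γ

@[simp] theorem tgt_gcell {x y : E.Obj} {m n : E.Pro x y} (γ : m ⟶ n) :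
    E.tgt (gcell γ) = 𝟙 y := Glob.tgt_cell γ

@[simp] theorem gcell_glob {x y : E.Obj} {m n : E.Pro x y} (γ : E.Cell m n) (hs : E.src γ = 𝟙 x)
    (ht : E.tgt γ = 𝟙 y) : gcell (glob γ hs ht) = γ := rfl

@[simp] theorem gcell_id {x y : E.Obj} (m : E.Pro x y) : gcell (𝟙 m) = E.one m := rfl

@[simp] theorem gcell_comp {x y : E.Obj} {m n p : E.Pro x y} (γ : m ⟶ n) (δ : n ⟶ p) :
    gcell (γ ≫ δ) = gcell γ ≫ᵥ gcell δ := rfl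

theorem gcell_ext {x y : E.Obj} {m n : E.Pro x y} {γ δ : m ⟶ n} (h : gcell γ = gcell δ) :
    γ = δ := Glob.ext h

theorem hcomp_congr {x y z x' y' z' : E.Obj} {m : E.Pro x y} {n : E.Pro y z} {m' : E.Pro x' y'}
    {n' : E.Pro y' z'} {γ γ' : E.Cell m m'} {δ δ' : E.Cell n n'} (h₁ : γ = γ') (h₂ : δ = δ')
    (h : E.tgt γ = E.src δ) (h' : E.tgt γ' = E.src δ') :
    E.hcomp γ δ h = E.hcomp γ' δ' h' := by
  subst h₁ h₂; rfl

/-- The globular cell `1_m ⊙ γ`. -/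
def whiskerL {x y z : E.Obj} (m : E.Pro x y) {n n' : E.Pro y z} (γ : n ⟶ n') :
    m ⊙ₚ n ⟶ m ⊙ₚ n' :=
  glob (E.hcomp (E.one m) (gcell γ) (by simp)) (by simp) (by simp)

/-- The globular cell `γ ⊙ 1_n`. -/
def whiskerR {x y z : E.Obj} {m m' : E.Pro x y} (γ : m ⟶ m') (n : E.Pro y z) :
    m ⊙ₚ n ⟶ m' ⊙ₚ n :=
  glob (E.hcomp (gcell γ) (E.one n) (by simp)) (by simp) (by simp)

theorem src_eq_id_of_inverse {x y : E.Obj} {m n : E.Pro x y} {γ : E.Cell m n} {δ : E.Cell n m}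
    (h : γ ≫ᵥ δ = E.one m) (hγ : E.src γ = 𝟙 x) : E.src δ = 𝟙 x := by
  have := congrArg E.src h
  simpa [hγ] using this

theorem tgt_eq_id_of_inverse {x y : E.Obj} {m n : E.Pro x y} {γ : E.Cell m n} {δ : E.Cell n m}
    (h : γ ≫ᵥ δ = E.one m) (hγ : E.tgt γ = 𝟙 y) : E.tgt δ = 𝟙 y := by
  have := congrArg E.tgt h
  simpa [hγ] using this

/-- The associator as an isomorphism of globular cells. -/
def assoc {x y z t : E.Obj} (m : E.Pro x y) (n : E.Pro y z) (p : E.Pro z t) :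
    (m ⊙ₚ n) ⊙ₚ p ≅ m ⊙ₚ n ⊙ₚ p where
  hom := glob (E.assocHom m n p) (by simp) (by simp)
  inv := glob (E.assocInv m n p)
    (src_eq_id_of_inverse (E.assoc_hom_inv m n p) (by simp))
    (tgt_eq_id_of_inverse (E.assoc_hom_inv m n p) (by simp))
  hom_inv_id := gcell_ext (E.assoc_hom_inv m n p)
  inv_hom_id := gcell_ext (E.assoc_inv_hom m n p)

/-- The left unitor as an isomorphism of globular cells. -/
def leftU {x y : E.Obj} (m : E.Pro x y) : E.idPro x ⊙ₚ m ≅ m where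
  hom := glob (E.leftHom m) (by simp) (by simp)
  inv := glob (E.leftInv m)
    (src_eq_id_of_inverse (E.left_hom_inv m) (by simp))
    (tgt_eq_id_of_inverse (E.left_hom_inv m) (by simp))
  hom_inv_id := gcell_ext (E.left_hom_inv m)
  inv_hom_id := gcell_ext (E.left_inv_hom m)

/-- The right unitor as an isomorphism of globular cells. -/
def rightU {x y : E.Obj} (m : E.Pro x y) : m ⊙ₚ E.idPro y ≅ m where
  hom := glob (E.rightHom m) (by simp) (by simp)
  inv := glob (E.rightInv m)
    (src_eq_id_of_inverse (E.right_hom_inv m) (by simp))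
    (tgt_eq_id_of_inverse (E.right_hom_inv m) (by simp))
  hom_inv_id := gcell_ext (E.right_hom_inv m)
  inv_hom_id := gcell_ext (E.right_inv_hom m)

@[simp] theorem gcell_assoc_hom {x y z t : E.Obj} (m : E.Pro x y) (n : E.Pro y z)
    (p : E.Pro z t) : gcell (assoc m n p).hom = E.assocHom m n p := rfl

@[simp] theorem gcell_assoc_inv {x y z t : E.Obj} (m : E.Pro x y) (n : E.Pro y z)
    (p : E.Pro z t) : gcell (assoc m n p).inv = E.assocInv m n p := rfl

@[simp] theorem gcell_leftU_hom {x y : E.Obj} (m : E.Pro x y) :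
    gcell (leftU m).hom = E.leftHom m := rfl

@[simp] theorem gcell_leftU_inv {x y : E.Obj} (m : E.Pro x y) :
    gcell (leftU m).inv = E.leftInv m := rfl

@[simp] theorem gcell_rightU_hom {x y : E.Obj} (m : E.Pro x y) :
    gcell (rightU m).hom = E.rightHom m := rfl

@[simp] theorem gcell_rightU_inv {x y : E.Obj} (m : E.Pro x y) :
    gcell (rightU m).inv = E.rightInv m := rfl

@[simp] theorem gcell_whiskerL {x y z : E.Obj} (m : E.Pro x y) {n n' : E.Pro y z} (γ : n ⟶ n') :
    gcell (whiskerL m γ) = E.hcomp (E.one m) (gcell γ) (by simp) := rfl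

@[simp] theorem gcell_whiskerR {x y z : E.Obj} {m m' : E.Pro x y} (γ : m ⟶ m') (n : E.Pro y z) :
    gcell (whiskerR γ n) = E.hcomp (gcell γ) (E.one n) (by simp) := rfl

@[simp] theorem src_assocInv {x y z t : E.Obj} (m : E.Pro x y) (n : E.Pro y z)
    (p : E.Pro z t) : E.src (E.assocInv m n p) = 𝟙 x := src_gcell (assoc m n p).inv

@[simp] theorem tgt_assocInv {x y z t : E.Obj} (m : E.Pro x y) (n : E.Pro y z)
    (p : E.Pro z t) : E.tgt (E.assocInv m n p) = 𝟙 t := tgt_gcell (assoc m n p).inv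

@[simp] theorem src_leftInv {x y : E.Obj} (m : E.Pro x y) : E.src (E.leftInv m) = 𝟙 x :=
  src_gcell (leftU m).inv

@[simp] theorem tgt_leftInv {x y : E.Obj} (m : E.Pro x y) : E.tgt (E.leftInv m) = 𝟙 y :=
  tgt_gcell (leftU m).inv

@[simp] theorem src_rightInv {x y : E.Obj} (m : E.Pro x y) : E.src (E.rightInv m) = 𝟙 x :=
  src_gcell (rightU m).inv

@[simp] theorem tgt_rightInv {x y : E.Obj} (m : E.Pro x y) : E.tgt (E.rightInv m) = 𝟙 y :=
  tgt_gcell (rightU m).inv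

/-- A square of cells whose horizontal sides are invertible can be turned around. -/
theorem inv_square {x y x' y' : E.Obj} {m n : E.Pro x y} {m' n' : E.Pro x' y'}
    {i : E.Cell m n} {j : E.Cell n m} {i' : E.Cell m' n'} {j' : E.Cell n' m'}
    (hij : j ≫ᵥ i = E.one n) (hij' : i' ≫ᵥ j' = E.one m')
    {γ : E.Cell m m'} {δ : E.Cell n n'} (h : γ ≫ᵥ i' = i ≫ᵥ δ) :
    δ ≫ᵥ j' = j ≫ᵥ γ := by
  calc δ ≫ᵥ j' = (j ≫ᵥ i) ≫ᵥ δ ≫ᵥ j' := by rw [hij, E.one_comp]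
    _ = j ≫ᵥ (i ≫ᵥ δ) ≫ᵥ j' := by simp only [E.comp_assoc]
    _ = j ≫ᵥ γ ≫ᵥ (i' ≫ᵥ j') := by rw [← h]; simp only [E.comp_assoc]
    _ = j ≫ᵥ γ := by rw [hij', E.comp_one]

theorem assocInv_naturality {x y z t x' y' z' t' : E.Obj} {m : E.Pro x y} {n : E.Pro y z}
    {p : E.Pro z t} {m' : E.Pro x' y'} {n' : E.Pro y' z'} {p' : E.Pro z' t'}
    (γ : E.Cell m m') (δ : E.Cell n n') (ε : E.Cell p p') (h : E.tgt γ = E.src δ)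
    (h' : E.tgt δ = E.src ε) :
    E.hcomp γ (E.hcomp δ ε h') (by simpa using h) ≫ᵥ E.assocInv m' n' p' =
      E.assocInv m n p ≫ᵥ E.hcomp (E.hcomp γ δ h) ε (by simpa using h') :=
  inv_square (E.assoc_inv_hom _ _ _) (E.assoc_hom_inv _ _ _) (E.assoc_naturality γ δ ε h h')

theorem leftInv_naturality {x y x' y' : E.Obj} {m : E.Pro x y} {m' : E.Pro x' y'} (f : x ⟶ x')
    (γ : E.Cell m m') (h : E.tgt (E.idCell f) = E.src γ) :
    γ ≫ᵥ E.leftInv m' = E.leftInv m ≫ᵥ E.hcomp (E.idCell f) γ h :=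
  inv_square (E.left_inv_hom _) (E.left_hom_inv _) (E.left_naturality f γ h)

theorem rightInv_naturality {x y x' y' : E.Obj} {m : E.Pro x y} {m' : E.Pro x' y'} (f : y ⟶ y')
    (γ : E.Cell m m') (h : E.tgt γ = E.src (E.idCell f)) :
    γ ≫ᵥ E.rightInv m' = E.rightInv m ≫ᵥ E.hcomp γ (E.idCell f) h :=
  inv_square (E.right_inv_hom _) (E.right_hom_inv _) (E.right_naturality f γ h)

/-- The objects of the bicategory underlying a double category. -/
def Loose (E : DoubleCategory.{u, v, w, r}) : Type u := E.Obj

theorem idPro_whiskerL {x y : E.Obj} {m n : E.Pro x y} (γ : m ⟶ n) :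
    whiskerL (E.idPro x) γ = (leftU m).hom ≫ γ ≫ (leftU n).inv := by
  rw [← Category.assoc, Iso.eq_comp_inv]
  apply gcell_ext
  have := E.left_naturality (𝟙 x) (gcell γ) (by simp)
  simpa using this

theorem whiskerR_idPro {x y : E.Obj} {m n : E.Pro x y} (γ : m ⟶ n) :
    whiskerR γ (E.idPro y) = (rightU m).hom ≫ γ ≫ (rightU n).inv := by
  rw [← Category.assoc, Iso.eq_comp_inv]
  apply gcell_ext
  have := E.right_naturality (𝟙 y) (gcell γ) (by simp)
  simpa using this

theorem assoc_naturality_glob {x y z t : E.Obj} {m m' : E.Pro x y} {n n' : E.Pro y z}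
    {p p' : E.Pro z t} (γ : m ⟶ m') (δ : n ⟶ n') (ε : p ⟶ p') :
    E.hcomp (E.hcomp (gcell γ) (gcell δ) (by simp)) (gcell ε) (by simp) ≫ᵥ E.assocHom m' n' p' =
    E.assocHom m n p ≫ᵥ E.hcomp (gcell γ) (E.hcomp (gcell δ) (gcell ε) (by simp)) (by simp) :=
  E.assoc_naturality _ _ _ _ _

theorem whiskerL_id {x y z : E.Obj} (m : E.Pro x y) (n : E.Pro y z) :
    whiskerL m (𝟙 n) = 𝟙 (m ⊙ₚ n) :=
  gcell_ext (E.hcomp_one m n)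

theorem whiskerR_id {x y z : E.Obj} (m : E.Pro x y) (n : E.Pro y z) :
    whiskerR (𝟙 m) n = 𝟙 (m ⊙ₚ n) :=
  gcell_ext (E.hcomp_one m n)

theorem whiskerL_comp {x y z : E.Obj} (m : E.Pro x y) {n p q : E.Pro y z} (γ : n ⟶ p)
    (δ : p ⟶ q) : whiskerL m (γ ≫ δ) = whiskerL m γ ≫ whiskerL m δ := by
  apply gcell_ext
  have := E.interchange (E.one m) (E.one m) (gcell γ) (gcell δ) (by simp) (by simp)
  simpa using this

theorem whiskerR_comp {x y z : E.Obj} {m n p : E.Pro x y} (γ : m ⟶ n)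
    (δ : n ⟶ p) (q : E.Pro y z) : whiskerR (γ ≫ δ) q = whiskerR γ q ≫ whiskerR δ q := by
  apply gcell_ext
  have := E.interchange (gcell γ) (gcell δ) (E.one q) (E.one q) (by simp) (by simp)
  simpa using this

theorem whiskerL_assoc {x y z t : E.Obj} (m : E.Pro x y) (n : E.Pro y z) {p q : E.Pro z t}
    (γ : p ⟶ q) : whiskerL (m ⊙ₚ n) γ =
      (assoc m n p).hom ≫ whiskerL m (whiskerL n γ) ≫ (assoc m n q).inv := by
  rw [← Category.assoc, Iso.eq_comp_inv]
  apply gcell_ext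
  have := assoc_naturality_glob (𝟙 m) (𝟙 n) γ
  simpa using this

theorem whiskerR_assoc {x y z t : E.Obj} {m m' : E.Pro x y} (γ : m ⟶ m') (n : E.Pro y z)
    (p : E.Pro z t) : whiskerR γ (n ⊙ₚ p) =
      (assoc m n p).inv ≫ whiskerR (whiskerR γ n) p ≫ (assoc m' n p).hom := by
  rw [Iso.eq_inv_comp]
  apply gcell_ext
  have := assoc_naturality_glob γ (𝟙 n) (𝟙 p)
  simpa using this.symm

theorem whiskerLR_assoc {x y z t : E.Obj} (m : E.Pro x y) {n n' : E.Pro y z} (γ : n ⟶ n')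
    (p : E.Pro z t) : whiskerR (whiskerL m γ) p =
      (assoc m n p).hom ≫ whiskerL m (whiskerR γ p) ≫ (assoc m n' p).inv := by
  rw [← Category.assoc, Iso.eq_comp_inv]
  apply gcell_ext
  exact assoc_naturality_glob (𝟙 m) γ (𝟙 p)

theorem whisker_swap {x y z : E.Obj} {m m' : E.Pro x y} {n n' : E.Pro y z} (γ : m ⟶ m')
    (δ : n ⟶ n') : whiskerL m δ ≫ whiskerR γ n' = whiskerR γ n ≫ whiskerL m' δ := by
  apply gcell_ext
  have h₁ := E.interchange (E.one m) (gcell γ) (gcell δ) (E.one n') (by simp) (by simp)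
  have h₂ := E.interchange (gcell γ) (E.one m') (E.one n) (gcell δ) (by simp) (by simp)
  simp only [one_comp, comp_one] at h₁ h₂
  exact h₁.symm.trans h₂

/-- The bicategory of objects, proarrows, and globular cells. -/
instance looseBicategory : Bicategory E.Loose where
  Hom x y := E.Pro x y
  id x := E.idPro x
  comp m n := E.pcomp m n
  homCategory x y := proCategory (E := E) x y
  whiskerLeft m _ _ γ := whiskerL (E := E) m γ
  whiskerRight γ n := whiskerR (E := E) γ n
  associator m n p := assoc (E := E) m n p
  leftUnitor m := leftU (E := E) m
  rightUnitor m := rightU (E := E) m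
  whiskerLeft_id m n := whiskerL_id (E := E) m n
  whiskerLeft_comp m _ _ _ γ δ := whiskerL_comp (E := E) m γ δ
  id_whiskerLeft γ := idPro_whiskerL (E := E) γ
  comp_whiskerLeft m n _ _ γ := whiskerL_assoc (E := E) m n γ
  id_whiskerRight m n := whiskerR_id (E := E) m n
  comp_whiskerRight γ δ n := whiskerR_comp (E := E) γ δ n
  whiskerRight_id γ := whiskerR_idPro (E := E) γ
  whiskerRight_comp γ n p := whiskerR_assoc (E := E) γ n p
  whisker_assoc m _ _ γ n := whiskerLR_assoc (E := E) m γ n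
  whisker_exchange γ δ := whisker_swap (E := E) γ δ
  pentagon m n p q := gcell_ext (E := E) (E.pentagon m n p q)
  triangle m n := gcell_ext (E := E) (E.triangle m n)

end Globular

section Pasting

open Bicategory

/-! Pasting identities valid in every bicategory. -/

variable {B : Type u} [Bicategory.{w, v} B]

/-- Pasting of two oplax comparison cells. -/
def bOplaxPaste {a b a' b' a'' b'' : B} {f : a ⟶ b} {f' : a' ⟶ b'} {f'' : a'' ⟶ b''}
    {s : a ⟶ a'} {s' : b ⟶ b'} {t : a' ⟶ a''} {t' : b' ⟶ b''}
    (γ : f ≫ s' ⟶ s ≫ f') (δ : f' ≫ t' ⟶ t ≫ f'') : f ≫ s' ≫ t' ⟶ (s ≫ t) ≫ f'' :=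
  (α_ f s' t').inv ≫ γ ▷ t' ≫ (α_ s f' t').hom ≫ s ◁ δ ≫ (α_ s t f'').inv

/-- Pasting of two lax comparison cells. -/
def bLaxPaste {a b a' b' a'' b'' : B} {f : a ⟶ b} {f' : a' ⟶ b'} {f'' : a'' ⟶ b''}
    {s : a ⟶ a'} {s' : b ⟶ b'} {t : a' ⟶ a''} {t' : b' ⟶ b''}
    (γ : s ≫ f' ⟶ f ≫ s') (δ : t ≫ f'' ⟶ f' ≫ t') : (s ≫ t) ≫ f'' ⟶ f ≫ s' ≫ t' :=
  (α_ s t f'').hom ≫ s ◁ δ ≫ (α_ s f' t').inv ≫ γ ▷ t' ≫ (α_ f s' t').hom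

theorem bOplaxPaste_id {a a' a'' : B} {f : a ⟶ a} {f' : a' ⟶ a'} {f'' : a'' ⟶ a''}
    {s : a ⟶ a'} {t : a' ⟶ a''} (i : 𝟙 a ⟶ f) (i' : 𝟙 a' ⟶ f') (i'' : 𝟙 a'' ⟶ f'')
    (γ : f ≫ s ⟶ s ≫ f') (δ : f' ≫ t ⟶ t ≫ f'')
    (hγ : i ▷ s ≫ γ = (λ_ s).hom ≫ (ρ_ s).inv ≫ s ◁ i')
    (hδ : i' ▷ t ≫ δ = (λ_ t).hom ≫ (ρ_ t).inv ≫ t ◁ i'') :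
    i ▷ (s ≫ t) ≫ bOplaxPaste γ δ =
      (λ_ (s ≫ t)).hom ≫ (ρ_ (s ≫ t)).inv ≫ (s ≫ t) ◁ i'' := by
  unfold bOplaxPaste
  calc
    _ = 𝟙 _ ⊗≫ (i ▷ s ≫ γ) ▷ t ⊗≫ s ◁ δ ⊗≫ 𝟙 _ := by bicategory
    _ = 𝟙 _ ⊗≫ s ◁ (i' ▷ t ≫ δ) ⊗≫ 𝟙 _ := by rw [hγ]; bicategory
    _ = _ := by rw [hδ]; bicategory

theorem bLaxPaste_id {a a' a'' : B} {f : a ⟶ a} {f' : a' ⟶ a'} {f'' : a'' ⟶ a''}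
    {s : a ⟶ a'} {t : a' ⟶ a''} (i : 𝟙 a ⟶ f) (i' : 𝟙 a' ⟶ f') (i'' : 𝟙 a'' ⟶ f'')
    (γ : s ≫ f' ⟶ f ≫ s) (δ : t ≫ f'' ⟶ f' ≫ t)
    (hγ : s ◁ i' ≫ γ = (ρ_ s).hom ≫ (λ_ s).inv ≫ i ▷ s)
    (hδ : t ◁ i'' ≫ δ = (ρ_ t).hom ≫ (λ_ t).inv ≫ i' ▷ t) :
    (s ≫ t) ◁ i'' ≫ bLaxPaste γ δ =
      (ρ_ (s ≫ t)).hom ≫ (λ_ (s ≫ t)).inv ≫ i ▷ (s ≫ t) := by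
  unfold bLaxPaste
  calc
    _ = 𝟙 _ ⊗≫ s ◁ (t ◁ i'' ≫ δ) ⊗≫ γ ▷ t ⊗≫ 𝟙 _ := by bicategory
    _ = 𝟙 _ ⊗≫ (s ◁ i' ≫ γ) ▷ t ⊗≫ 𝟙 _ := by rw [hδ]; bicategory
    _ = _ := by rw [hγ]; bicategory

theorem bOplaxPaste_comp {a b c a' b' c' a'' b'' c'' : B}
    {f : a ⟶ b} {g : b ⟶ c} {k : a ⟶ c} {f' : a' ⟶ b'} {g' : b' ⟶ c'} {k' : a' ⟶ c'}
    {f'' : a'' ⟶ b''} {g'' : b'' ⟶ c''} {k'' : a'' ⟶ c''}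
    {s₁ : a ⟶ a'} {s₂ : b ⟶ b'} {s₃ : c ⟶ c'} {t₁ : a' ⟶ a''} {t₂ : b' ⟶ b''} {t₃ : c' ⟶ c''}
    (i : f ≫ g ⟶ k) (i' : f' ≫ g' ⟶ k') (i'' : f'' ≫ g'' ⟶ k'')
    (γf : f ≫ s₂ ⟶ s₁ ≫ f') (γg : g ≫ s₃ ⟶ s₂ ≫ g') (γk : k ≫ s₃ ⟶ s₁ ≫ k')
    (δf : f' ≫ t₂ ⟶ t₁ ≫ f'') (δg : g' ≫ t₃ ⟶ t₂ ≫ g'') (δk : k' ≫ t₃ ⟶ t₁ ≫ k'')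
    (hγ : i ▷ s₃ ≫ γk = (α_ f g s₃).hom ≫ f ◁ γg ≫ (α_ f s₂ g').inv ≫ γf ▷ g' ≫
      (α_ s₁ f' g').hom ≫ s₁ ◁ i')
    (hδ : i' ▷ t₃ ≫ δk = (α_ f' g' t₃).hom ≫ f' ◁ δg ≫ (α_ f' t₂ g'').inv ≫ δf ▷ g'' ≫
      (α_ t₁ f'' g'').hom ≫ t₁ ◁ i'') :
    i ▷ (s₃ ≫ t₃) ≫ bOplaxPaste γk δk =
      (α_ f g (s₃ ≫ t₃)).hom ≫ f ◁ bOplaxPaste γg δg ≫ (α_ f (s₂ ≫ t₂) g'').inv ≫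
        bOplaxPaste γf δf ▷ g'' ≫ (α_ (s₁ ≫ t₁) f'' g'').hom ≫ (s₁ ≫ t₁) ◁ i'' := by
  unfold bOplaxPaste
  calc
    _ = 𝟙 _ ⊗≫ (i ▷ s₃ ≫ γk) ▷ t₃ ⊗≫ s₁ ◁ δk ⊗≫ 𝟙 _ := by bicategory
    _ = 𝟙 _ ⊗≫ (f ◁ γg ⊗≫ γf ▷ g') ▷ t₃ ⊗≫ s₁ ◁ (i' ▷ t₃ ≫ δk) ⊗≫ 𝟙 _ := by
      rw [hγ]; bicategory
    _ = 𝟙 _ ⊗≫ f ◁ γg ▷ t₃ ⊗≫ (γf ▷ (g' ≫ t₃) ≫ (s₁ ≫ f') ◁ δg) ⊗≫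
          s₁ ◁ (δf ▷ g'' ⊗≫ t₁ ◁ i'') ⊗≫ 𝟙 _ := by
      rw [hδ]; bicategory
    _ = _ := by rw [← whisker_exchange]; bicategory

theorem bLaxPaste_comp {a b c a' b' c' a'' b'' c'' : B}
    {f : a ⟶ b} {g : b ⟶ c} {k : a ⟶ c} {f' : a' ⟶ b'} {g' : b' ⟶ c'} {k' : a' ⟶ c'}
    {f'' : a'' ⟶ b''} {g'' : b'' ⟶ c''} {k'' : a'' ⟶ c''}
    {s₁ : a ⟶ a'} {s₂ : b ⟶ b'} {s₃ : c ⟶ c'} {t₁ : a' ⟶ a''} {t₂ : b' ⟶ b''} {t₃ : c' ⟶ c''}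
    (i : f ≫ g ⟶ k) (i' : f' ≫ g' ⟶ k') (i'' : f'' ≫ g'' ⟶ k'')
    (γf : s₁ ≫ f' ⟶ f ≫ s₂) (γg : s₂ ≫ g' ⟶ g ≫ s₃) (γk : s₁ ≫ k' ⟶ k ≫ s₃)
    (δf : t₁ ≫ f'' ⟶ f' ≫ t₂) (δg : t₂ ≫ g'' ⟶ g' ≫ t₃) (δk : t₁ ≫ k'' ⟶ k' ≫ t₃)
    (hγ : s₁ ◁ i' ≫ γk = (α_ s₁ f' g').inv ≫ γf ▷ g' ≫ (α_ f s₂ g').hom ≫ f ◁ γg ≫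
      (α_ f g s₃).inv ≫ i ▷ s₃)
    (hδ : t₁ ◁ i'' ≫ δk = (α_ t₁ f'' g'').inv ≫ δf ▷ g'' ≫ (α_ f' t₂ g'').hom ≫ f' ◁ δg ≫
      (α_ f' g' t₃).inv ≫ i' ▷ t₃) :
    (s₁ ≫ t₁) ◁ i'' ≫ bLaxPaste γk δk =
      (α_ (s₁ ≫ t₁) f'' g'').inv ≫ bLaxPaste γf δf ▷ g'' ≫ (α_ f (s₂ ≫ t₂) g'').hom ≫
        f ◁ bLaxPaste γg δg ≫ (α_ f g (s₃ ≫ t₃)).inv ≫ i ▷ (s₃ ≫ t₃) := by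
  unfold bLaxPaste
  calc
    _ = 𝟙 _ ⊗≫ s₁ ◁ (t₁ ◁ i'' ≫ δk) ⊗≫ γk ▷ t₃ ⊗≫ 𝟙 _ := by bicategory
    _ = 𝟙 _ ⊗≫ s₁ ◁ (δf ▷ g'' ⊗≫ f' ◁ δg) ⊗≫ (s₁ ◁ i' ≫ γk) ▷ t₃ ⊗≫ 𝟙 _ := by
      rw [hδ]; bicategory
    _ = 𝟙 _ ⊗≫ s₁ ◁ δf ▷ g'' ⊗≫ ((s₁ ≫ f') ◁ δg ≫ γf ▷ (g' ≫ t₃)) ⊗≫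
          (f ◁ γg ⊗≫ i ▷ s₃) ▷ t₃ ⊗≫ 𝟙 _ := by
      rw [hγ]; bicategory
    _ = _ := by rw [whisker_exchange]; bicategory

theorem bOplaxPaste_assoc {a b a' b' a'' b'' c d : B} {f : a ⟶ b} {f' : a' ⟶ b'}
    {f'' : a'' ⟶ b''} {f₃ : c ⟶ d}
    {s : a ⟶ a'} {s' : b ⟶ b'} {t : a' ⟶ a''} {t' : b' ⟶ b''} {r : a'' ⟶ c} {r' : b'' ⟶ d}
    (γ : f ≫ s' ⟶ s ≫ f') (δ : f' ≫ t' ⟶ t ≫ f'') (κ : f'' ≫ r' ⟶ r ≫ f₃) :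
    bOplaxPaste (bOplaxPaste γ δ) κ ≫ (α_ s t r).hom ▷ f₃ =
      f ◁ (α_ s' t' r').hom ≫ bOplaxPaste γ (bOplaxPaste δ κ) := by
  unfold bOplaxPaste
  bicategory

theorem bLaxPaste_assoc {a b a' b' a'' b'' c d : B} {f : a ⟶ b} {f' : a' ⟶ b'}
    {f'' : a'' ⟶ b''} {f₃ : c ⟶ d}
    {s : a ⟶ a'} {s' : b ⟶ b'} {t : a' ⟶ a''} {t' : b' ⟶ b''} {r : a'' ⟶ c} {r' : b'' ⟶ d}
    (γ : s ≫ f' ⟶ f ≫ s') (δ : t ≫ f'' ⟶ f' ≫ t') (κ : r ≫ f₃ ⟶ f'' ≫ r') :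
    bLaxPaste (bLaxPaste γ δ) κ ≫ f ◁ (α_ s' t' r').hom =
      (α_ s t r).hom ▷ f₃ ≫ bLaxPaste γ (bLaxPaste δ κ) := by
  unfold bLaxPaste
  bicategory

theorem bOplaxPaste_left {a b a' b' : B} {f : a ⟶ b} {f' : a' ⟶ b'}
    {s : a ⟶ a'} {s' : b ⟶ b'} (γ : f ≫ s' ⟶ s ≫ f') :
    bOplaxPaste ((ρ_ f).hom ≫ (λ_ f).inv) γ ≫ (λ_ s).hom ▷ f' = f ◁ (λ_ s').hom ≫ γ := by
  unfold bOplaxPaste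
  bicategory

theorem bOplaxPaste_right {a b a' b' : B} {f : a ⟶ b} {f' : a' ⟶ b'}
    {s : a ⟶ a'} {s' : b ⟶ b'} (γ : f ≫ s' ⟶ s ≫ f') :
    bOplaxPaste γ ((ρ_ f').hom ≫ (λ_ f').inv) ≫ (ρ_ s).hom ▷ f' = f ◁ (ρ_ s').hom ≫ γ := by
  unfold bOplaxPaste
  bicategory

theorem bLaxPaste_left {a b a' b' : B} {f : a ⟶ b} {f' : a' ⟶ b'}
    {s : a ⟶ a'} {s' : b ⟶ b'} (γ : s ≫ f' ⟶ f ≫ s') :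
    bLaxPaste ((λ_ f).hom ≫ (ρ_ f).inv) γ ≫ f ◁ (λ_ s').hom = (λ_ s).hom ▷ f' ≫ γ := by
  unfold bLaxPaste
  bicategory

theorem bLaxPaste_right {a b a' b' : B} {f : a ⟶ b} {f' : a' ⟶ b'}
    {s : a ⟶ a'} {s' : b ⟶ b'} (γ : s ≫ f' ⟶ f ≫ s') :
    bLaxPaste γ ((λ_ f').hom ≫ (ρ_ f').inv) ≫ f ◁ (ρ_ s').hom = (ρ_ s).hom ▷ f' ≫ γ := by
  unfold bLaxPaste
  bicategory

theorem bOplaxId_id {a : B} {f : a ⟶ a} (i : 𝟙 a ⟶ f) :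
    i ▷ 𝟙 a ≫ (ρ_ f).hom ≫ (λ_ f).inv = (λ_ (𝟙 a)).hom ≫ (ρ_ (𝟙 a)).inv ≫ 𝟙 a ◁ i := by
  bicategory

theorem bLaxId_id {a : B} {f : a ⟶ a} (i : 𝟙 a ⟶ f) :
    𝟙 a ◁ i ≫ (λ_ f).hom ≫ (ρ_ f).inv = (ρ_ (𝟙 a)).hom ≫ (λ_ (𝟙 a)).inv ≫ i ▷ 𝟙 a := by
  bicategory

theorem bOplaxId_comp {a b c : B} {f : a ⟶ b} {g : b ⟶ c} {k : a ⟶ c} (i : f ≫ g ⟶ k) :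
    i ▷ 𝟙 c ≫ (ρ_ k).hom ≫ (λ_ k).inv =
      (α_ f g (𝟙 c)).hom ≫ f ◁ ((ρ_ g).hom ≫ (λ_ g).inv) ≫ (α_ f (𝟙 b) g).inv ≫
        ((ρ_ f).hom ≫ (λ_ f).inv) ▷ g ≫ (α_ (𝟙 a) f g).hom ≫ 𝟙 a ◁ i := by
  bicategory

theorem bLaxId_comp {a b c : B} {f : a ⟶ b} {g : b ⟶ c} {k : a ⟶ c} (i : f ≫ g ⟶ k) :
    𝟙 a ◁ i ≫ (λ_ k).hom ≫ (ρ_ k).inv =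
      (α_ (𝟙 a) f g).inv ≫ ((λ_ f).hom ≫ (ρ_ f).inv) ▷ g ≫ (α_ f (𝟙 b) g).hom ≫
        f ◁ ((λ_ g).hom ≫ (ρ_ g).inv) ≫ (α_ f g (𝟙 c)).inv ≫ i ▷ 𝟙 c := by
  bicategory

end Pasting

end DoubleCategory

open DoubleCategory

/-- A lax double functor. -/
structure LaxFunctor (D : DoubleCategory.{u₁, v₁, w₁, r₁})
    (E : DoubleCategory.{u₂, v₂, w₂, r₂}) where
  /-- The action on objects and arrows. -/
  base : D.Obj ⥤ E.Obj
  pro : ∀ {x y : D.Obj}, D.Pro x y → E.Pro (base.obj x) (base.obj y)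
  cell : ∀ {x y x' y' : D.Obj} {m : D.Pro x y} {n : D.Pro x' y'},
    D.Cell m n → E.Cell (pro m) (pro n)
  src_cell : ∀ {x y x' y' : D.Obj} {m : D.Pro x y} {n : D.Pro x' y'} (γ : D.Cell m n),
    E.src (cell γ) = base.map (D.src γ)
  tgt_cell : ∀ {x y x' y' : D.Obj} {m : D.Pro x y} {n : D.Pro x' y'} (γ : D.Cell m n),
    E.tgt (cell γ) = base.map (D.tgt γ)
  cell_one : ∀ {x y : D.Obj} (m : D.Pro x y), cell (D.one m) = E.one (pro m)
  cell_comp : ∀ {x y x' y' x'' y'' : D.Obj} {m : D.Pro x y} {n : D.Pro x' y'}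
    {p : D.Pro x'' y''} (γ : D.Cell m n) (δ : D.Cell n p),
    cell (γ ≫ᵥ δ) = cell γ ≫ᵥ cell δ
  /-- The globular laxator `F_{m,n} : F m ⊙ F n ⟶ F (m ⊙ n)`. -/
  laxComp : ∀ {x y z : D.Obj} (m : D.Pro x y) (n : D.Pro y z), pro m ⊙ₚ pro n ⟶ pro (m ⊙ₚ n)
  /-- The globular unitor `F_x : id_{F x} ⟶ F id_x`. -/
  laxId : ∀ x : D.Obj, E.idPro (base.obj x) ⟶ pro (D.idPro x)
  laxComp_naturality : ∀ {x y z x' y' z' : D.Obj} {m : D.Pro x y} {n : D.Pro y z}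
    {m' : D.Pro x' y'} {n' : D.Pro y' z'} (γ : D.Cell m m') (δ : D.Cell n n')
    (h : D.tgt γ = D.src δ),
    E.hcomp (cell γ) (cell δ) (by rw [tgt_cell, src_cell, h]) ≫ᵥ gcell (laxComp m' n') =
      gcell (laxComp m n) ≫ᵥ cell (D.hcomp γ δ h)
  laxId_naturality : ∀ {x y : D.Obj} (f : x ⟶ y),
    E.idCell (base.map f) ≫ᵥ gcell (laxId y) = gcell (laxId x) ≫ᵥ cell (D.idCell f)
  lax_assoc : ∀ {x y z t : D.Obj} (m : D.Pro x y) (n : D.Pro y z) (p : D.Pro z t),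
    gcell (whiskerR (laxComp m n) (pro p) ≫ laxComp (m ⊙ₚ n) p) ≫ᵥ cell (D.assocHom m n p) =
      gcell ((assoc (pro m) (pro n) (pro p)).hom ≫ whiskerL (pro m) (laxComp n p) ≫
        laxComp m (n ⊙ₚ p))
  lax_left : ∀ {x y : D.Obj} (m : D.Pro x y),
    gcell (whiskerR (laxId x) (pro m) ≫ laxComp (D.idPro x) m) ≫ᵥ cell (D.leftHom m) =
      E.leftHom (pro m)
  lax_right : ∀ {x y : D.Obj} (m : D.Pro x y),
    gcell (whiskerL (pro m) (laxId y) ≫ laxComp m (D.idPro y)) ≫ᵥ cell (D.rightHom m) =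
      E.rightHom (pro m)

attribute [simp] LaxFunctor.src_cell LaxFunctor.tgt_cell

section Transformations

variable {D : DoubleCategory.{u₁, v₁, w₁, r₁}} {E : DoubleCategory.{u₂, v₂, w₂, r₂}}

/-- A (tight, strict) natural transformation between lax double functors. -/
@[ext]
structure Transformation (F G : LaxFunctor D E) where
  /-- The components at objects, natural with respect to arrows. -/
  base : F.base ⟶ G.base
  /-- The component at a proarrow. -/
  cell : ∀ {x y : D.Obj} (m : D.Pro x y), E.Cell (F.pro m) (G.pro m)
  src_cell : ∀ {x y : D.Obj} (m : D.Pro x y), E.src (cell m) = base.app x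
  tgt_cell : ∀ {x y : D.Obj} (m : D.Pro x y), E.tgt (cell m) = base.app y
  cell_naturality : ∀ {x y x' y' : D.Obj} {m : D.Pro x y} {n : D.Pro x' y'} (γ : D.Cell m n),
    F.cell γ ≫ᵥ cell n = cell m ≫ᵥ G.cell γ
  cell_pcomp : ∀ {x y z : D.Obj} (m : D.Pro x y) (n : D.Pro y z),
    gcell (F.laxComp m n) ≫ᵥ cell (m ⊙ₚ n) =
      E.hcomp (cell m) (cell n) (by rw [tgt_cell, src_cell]) ≫ᵥ gcell (G.laxComp m n)
  cell_idPro : ∀ x : D.Obj,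
    gcell (F.laxId x) ≫ᵥ cell (D.idPro x) = E.idCell (base.app x) ≫ᵥ gcell (G.laxId x)

attribute [simp] Transformation.src_cell Transformation.tgt_cell

/-- The identity natural transformation. -/
def Transformation.id (F : LaxFunctor D E) : Transformation F F where
  base := 𝟙 F.base
  cell m := E.one (F.pro m)
  src_cell m := by simp
  tgt_cell m := by simp
  cell_naturality γ := by simp
  cell_pcomp m n := by simp
  cell_idPro x := by simp

/-- Composition of natural transformations. -/
def Transformation.comp {F G H : LaxFunctor D E} (α : Transformation F G)
    (β : Transformation G H) : Transformation F H where
  base := α.base ≫ β.base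
  cell m := α.cell m ≫ᵥ β.cell m
  src_cell m := by simp
  tgt_cell m := by simp
  cell_naturality γ := by
    rw [← E.comp_assoc, α.cell_naturality, E.comp_assoc, β.cell_naturality, E.comp_assoc]
  cell_pcomp m n := by
    rw [← E.comp_assoc, α.cell_pcomp, E.comp_assoc, β.cell_pcomp, ← E.comp_assoc,
      E.interchange]
  cell_idPro x := by
    rw [← E.comp_assoc, α.cell_idPro, E.comp_assoc, β.cell_idPro, ← E.comp_assoc,
      ← E.idCell_comp, NatTrans.comp_app]

instance laxFunctorCategory : Category (LaxFunctor D E) where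
  Hom F G := Transformation F G
  id F := Transformation.id F
  comp α β := Transformation.comp α β
  id_comp α := Transformation.ext (Category.id_comp _) (by
    funext x y m; exact E.one_comp _)
  comp_id α := Transformation.ext (Category.comp_id _) (by
    funext x y m; exact E.comp_one _)
  assoc α β γ := Transformation.ext (Category.assoc _ _ _) (by
    funext x y m; exact E.comp_assoc _ _ _)

/-- The component `α_x : F x ⟶ G x` of a natural transformation at an object. -/
def tapp {F G : LaxFunctor D E} (α : F ⟶ G) (x : D.Obj) : F.base.obj x ⟶ G.base.obj x :=
  (Transformation.base α).app x

/-- The component `α_m` of a natural transformation at a proarrow. -/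
def tcell {F G : LaxFunctor D E} (α : F ⟶ G) {x y : D.Obj} (m : D.Pro x y) :
    E.Cell (F.pro m) (G.pro m) :=
  Transformation.cell α m

@[simp] theorem tapp_id (F : LaxFunctor D E) (x : D.Obj) : tapp (𝟙 F) x = 𝟙 _ := rfl

@[simp] theorem tapp_comp {F G H : LaxFunctor D E} (α : F ⟶ G) (β : G ⟶ H) (x : D.Obj) :
    tapp (α ≫ β) x = tapp α x ≫ tapp β x := rfl

@[simp] theorem tcell_id (F : LaxFunctor D E) {x y : D.Obj} (m : D.Pro x y) :
    tcell (𝟙 F) m = E.one _ := rfl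

@[simp] theorem tcell_comp {F G H : LaxFunctor D E} (α : F ⟶ G) (β : G ⟶ H) {x y : D.Obj}
    (m : D.Pro x y) : tcell (α ≫ β) m = tcell α m ≫ᵥ tcell β m := rfl

@[simp] theorem src_tcell {F G : LaxFunctor D E} (α : F ⟶ G) {x y : D.Obj} (m : D.Pro x y) :
    E.src (tcell α m) = tapp α x := Transformation.src_cell α m

@[simp] theorem tgt_tcell {F G : LaxFunctor D E} (α : F ⟶ G) {x y : D.Obj} (m : D.Pro x y) :
    E.tgt (tcell α m) = tapp α y := Transformation.tgt_cell α m

theorem tapp_naturality {F G : LaxFunctor D E} (α : F ⟶ G) {x y : D.Obj} (f : x ⟶ y) :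
    F.base.map f ≫ tapp α y = tapp α x ≫ G.base.map f :=
  (Transformation.base α).naturality f

/-- A lax protransformation `F ⇸ G`. -/
structure LaxProtransformation (F G : LaxFunctor D E) where
  /-- The component at an object. -/
  app : ∀ x : D.Obj, E.Pro (F.base.obj x) (G.base.obj x)
  /-- The component at an arrow. -/
  arr : ∀ {x y : D.Obj} (_ : x ⟶ y), E.Cell (app x) (app y)
  src_arr : ∀ {x y : D.Obj} (f : x ⟶ y), E.src (arr f) = F.base.map f
  tgt_arr : ∀ {x y : D.Obj} (f : x ⟶ y), E.tgt (arr f) = G.base.map f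
  /-- The globular naturality comparison at a proarrow. -/
  nat : ∀ {x y : D.Obj} (m : D.Pro x y), app x ⊙ₚ G.pro m ⟶ F.pro m ⊙ₚ app y
  arr_id : ∀ x : D.Obj, arr (𝟙 x) = E.one (app x)
  arr_comp : ∀ {x y z : D.Obj} (f : x ⟶ y) (g : y ⟶ z), arr (f ≫ g) = arr f ≫ᵥ arr g
  nat_cell : ∀ {x y x' y' : D.Obj} {m : D.Pro x y} {n : D.Pro x' y'} (γ : D.Cell m n),
    gcell (nat m) ≫ᵥ E.hcomp (F.cell γ) (arr (D.tgt γ)) (by rw [F.tgt_cell, src_arr]) =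
      E.hcomp (arr (D.src γ)) (G.cell γ) (by rw [G.src_cell, tgt_arr]) ≫ᵥ gcell (nat n)
  nat_pcomp : ∀ {x y z : D.Obj} (m : D.Pro x y) (n : D.Pro y z),
    whiskerL (app x) (G.laxComp m n) ≫ nat (m ⊙ₚ n) =
      (assoc (app x) (G.pro m) (G.pro n)).inv ≫ whiskerR (nat m) (G.pro n) ≫
        (assoc (F.pro m) (app y) (G.pro n)).hom ≫ whiskerL (F.pro m) (nat n) ≫
          (assoc (F.pro m) (F.pro n) (app z)).inv ≫ whiskerR (F.laxComp m n) (app z)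
  nat_idPro : ∀ x : D.Obj,
    whiskerL (app x) (G.laxId x) ≫ nat (D.idPro x) =
      (rightU (app x)).hom ≫ (leftU (app x)).inv ≫ whiskerR (F.laxId x) (app x)

/-- An oplax protransformation `F ⇸ G`. -/
structure OplaxProtransformation (F G : LaxFunctor D E) where
  /-- The component at an object. -/
  app : ∀ x : D.Obj, E.Pro (F.base.obj x) (G.base.obj x)
  /-- The component at an arrow. -/
  arr : ∀ {x y : D.Obj} (_ : x ⟶ y), E.Cell (app x) (app y)
  src_arr : ∀ {x y : D.Obj} (f : x ⟶ y), E.src (arr f) = F.base.map f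
  tgt_arr : ∀ {x y : D.Obj} (f : x ⟶ y), E.tgt (arr f) = G.base.map f
  /-- The globular naturality comparison at a proarrow. -/
  nat : ∀ {x y : D.Obj} (m : D.Pro x y), F.pro m ⊙ₚ app y ⟶ app x ⊙ₚ G.pro m
  arr_id : ∀ x : D.Obj, arr (𝟙 x) = E.one (app x)
  arr_comp : ∀ {x y z : D.Obj} (f : x ⟶ y) (g : y ⟶ z), arr (f ≫ g) = arr f ≫ᵥ arr g
  nat_cell : ∀ {x y x' y' : D.Obj} {m : D.Pro x y} {n : D.Pro x' y'} (γ : D.Cell m n),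
    gcell (nat m) ≫ᵥ E.hcomp (arr (D.src γ)) (G.cell γ) (by rw [G.src_cell, tgt_arr]) =
      E.hcomp (F.cell γ) (arr (D.tgt γ)) (by rw [F.tgt_cell, src_arr]) ≫ᵥ gcell (nat n)
  nat_pcomp : ∀ {x y z : D.Obj} (m : D.Pro x y) (n : D.Pro y z),
    whiskerR (F.laxComp m n) (app z) ≫ nat (m ⊙ₚ n) =
      (assoc (F.pro m) (F.pro n) (app z)).hom ≫ whiskerL (F.pro m) (nat n) ≫
        (assoc (F.pro m) (app y) (G.pro n)).inv ≫ whiskerR (nat m) (G.pro n) ≫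
          (assoc (app x) (G.pro m) (G.pro n)).hom ≫ whiskerL (app x) (G.laxComp m n)
  nat_idPro : ∀ x : D.Obj,
    whiskerR (F.laxId x) (app x) ≫ nat (D.idPro x) =
      (leftU (app x)).hom ≫ (rightU (app x)).inv ≫ whiskerL (app x) (G.laxId x)

attribute [simp] LaxProtransformation.src_arr LaxProtransformation.tgt_arr
  OplaxProtransformation.src_arr OplaxProtransformation.tgt_arr
  LaxProtransformation.arr_id OplaxProtransformation.arr_id

/-- A modification between oplax protransformations `σ : F ⇸ G` and `τ : H ⇸ K`, with its
bounding natural transformations `left : F ⟶ H` and `right : G ⟶ K`. -/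
@[ext]
structure OplaxModification {F G H K : LaxFunctor D E} (σ : OplaxProtransformation F G)
    (τ : OplaxProtransformation H K) where
  left : F ⟶ H
  right : G ⟶ K
  app : ∀ x : D.Obj, E.Cell (σ.app x) (τ.app x)
  src_app : ∀ x : D.Obj, E.src (app x) = tapp left x
  tgt_app : ∀ x : D.Obj, E.tgt (app x) = tapp right x
  /-- Internal equivariance. -/
  app_arr : ∀ {x y : D.Obj} (f : x ⟶ y), app x ≫ᵥ τ.arr f = σ.arr f ≫ᵥ app y
  /-- External equivariance. -/
  app_nat : ∀ {x y : D.Obj} (m : D.Pro x y),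
    gcell (σ.nat m) ≫ᵥ E.hcomp (app x) (tcell right m) (by rw [tgt_app, src_tcell]) =
      E.hcomp (tcell left m) (app y) (by rw [src_app, tgt_tcell]) ≫ᵥ gcell (τ.nat m)

/-- A modification between lax protransformations `σ : F ⇸ G` and `τ : H ⇸ K`, with its
bounding natural transformations `left : F ⟶ H` and `right : G ⟶ K`. -/
@[ext]
structure LaxModification {F G H K : LaxFunctor D E} (σ : LaxProtransformation F G)
    (τ : LaxProtransformation H K) where
  left : F ⟶ H
  right : G ⟶ K
  app : ∀ x : D.Obj, E.Cell (σ.app x) (τ.app x)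
  src_app : ∀ x : D.Obj, E.src (app x) = tapp left x
  tgt_app : ∀ x : D.Obj, E.tgt (app x) = tapp right x
  /-- Internal equivariance. -/
  app_arr : ∀ {x y : D.Obj} (f : x ⟶ y), app x ≫ᵥ τ.arr f = σ.arr f ≫ᵥ app y
  /-- External equivariance. -/
  app_nat : ∀ {x y : D.Obj} (m : D.Pro x y),
    gcell (σ.nat m) ≫ᵥ E.hcomp (tcell left m) (app y) (by rw [src_app, tgt_tcell]) =
      E.hcomp (app x) (tcell right m) (by rw [tgt_app, src_tcell]) ≫ᵥ gcell (τ.nat m)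

attribute [simp] OplaxModification.src_app OplaxModification.tgt_app
  LaxModification.src_app LaxModification.tgt_app

/-! ### The double category of oplax protransformations -/

/-- The comparison cell of a composite of oplax protransformations. -/
def oplaxPaste {a b a' b' a'' b'' : E.Obj} {f : E.Pro a b} {f' : E.Pro a' b'}
    {f'' : E.Pro a'' b''} {s : E.Pro a a'} {s' : E.Pro b b'} {t : E.Pro a' a''}
    {t' : E.Pro b' b''} (γ : f ⊙ₚ s' ⟶ s ⊙ₚ f') (δ : f' ⊙ₚ t' ⟶ t ⊙ₚ f'') :
    f ⊙ₚ s' ⊙ₚ t' ⟶ (s ⊙ₚ t) ⊙ₚ f'' :=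
  (assoc f s' t').inv ≫ whiskerR γ t' ≫ (assoc s f' t').hom ≫ whiskerL s δ ≫ (assoc s t f'').inv

/-- The comparison cell of a composite of lax protransformations. -/
def laxPaste {a b a' b' a'' b'' : E.Obj} {f : E.Pro a b} {f' : E.Pro a' b'}
    {f'' : E.Pro a'' b''} {s : E.Pro a a'} {s' : E.Pro b b'} {t : E.Pro a' a''}
    {t' : E.Pro b' b''} (γ : s ⊙ₚ f' ⟶ f ⊙ₚ s') (δ : t ⊙ₚ f'' ⟶ f' ⊙ₚ t') :
    (s ⊙ₚ t) ⊙ₚ f'' ⟶ f ⊙ₚ s' ⊙ₚ t' :=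
  (assoc s t f'').hom ≫ whiskerL s δ ≫ (assoc s f' t').inv ≫ whiskerR γ t' ≫ (assoc f s' t').hom

theorem whiskerR_square {x y z x' y' z' : E.Obj} {m n : E.Pro x y} {p : E.Pro y z}
    {m' n' : E.Pro x' y'} {p' : E.Pro y' z'} (i : m ⟶ n) (i' : m' ⟶ n') {γ : E.Cell m m'}
    {δ : E.Cell n n'} {ε : E.Cell p p'} (h : E.tgt γ = E.src ε) (h' : E.tgt δ = E.src ε)
    (e : gcell i ≫ᵥ δ = γ ≫ᵥ gcell i') :
    gcell (whiskerR i p) ≫ᵥ E.hcomp δ ε h' = E.hcomp γ ε h ≫ᵥ gcell (whiskerR i' p') := by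
  simp only [gcell_whiskerR]
  rw [← E.interchange, ← E.interchange]
  exact hcomp_congr e (by simp) _ _

theorem whiskerL_square {x y z x' y' z' : E.Obj} {m n : E.Pro y z} {p : E.Pro x y}
    {m' n' : E.Pro y' z'} {p' : E.Pro x' y'} (i : m ⟶ n) (i' : m' ⟶ n') {γ : E.Cell m m'}
    {δ : E.Cell n n'} {ε : E.Cell p p'} (h : E.tgt ε = E.src γ) (h' : E.tgt ε = E.src δ)
    (e : gcell i ≫ᵥ δ = γ ≫ᵥ gcell i') :
    gcell (whiskerL p i) ≫ᵥ E.hcomp ε δ h' = E.hcomp ε γ h ≫ᵥ gcell (whiskerL p' i') := by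
  simp only [gcell_whiskerL]
  rw [← E.interchange, ← E.interchange]
  exact hcomp_congr (by simp) e _ _

/-- Squares of cells with globular horizontal sides paste. -/
theorem square_comp {x y x' y' : E.Obj} {m n p : E.Pro x y} {m' n' p' : E.Pro x' y'}
    {i : m ⟶ n} {i' : m' ⟶ n'} {j : n ⟶ p} {j' : n' ⟶ p'} {γ : E.Cell m m'} {δ : E.Cell n n'}
    {ε : E.Cell p p'} (h : gcell i ≫ᵥ δ = γ ≫ᵥ gcell i') (h' : gcell j ≫ᵥ ε = δ ≫ᵥ gcell j') :
    gcell (i ≫ j) ≫ᵥ ε = γ ≫ᵥ gcell (i' ≫ j') := by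
  simp only [gcell_comp, E.comp_assoc]
  rw [h', ← E.comp_assoc, h, E.comp_assoc]

theorem oplaxPaste_square {a b a' b' a'' b'' : E.Obj} {f : E.Pro a b} {f' : E.Pro a' b'}
    {f'' : E.Pro a'' b''} {s : E.Pro a a'} {s' : E.Pro b b'} {t : E.Pro a' a''}
    {t' : E.Pro b' b''}
    {c d c' d' c'' d'' : E.Obj} {g : E.Pro c d} {g' : E.Pro c' d'}
    {g'' : E.Pro c'' d''} {u : E.Pro c c'} {u' : E.Pro d d'} {v : E.Pro c' c''}
    {v' : E.Pro d' d''}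
    (γ : f ⊙ₚ s' ⟶ s ⊙ₚ f') (δ : f' ⊙ₚ t' ⟶ t ⊙ₚ f'')
    (γ' : g ⊙ₚ u' ⟶ u ⊙ₚ g') (δ' : g' ⊙ₚ v' ⟶ v ⊙ₚ g'')
    (A : E.Cell f g) (A' : E.Cell f' g') (A'' : E.Cell f'' g'')
    (P : E.Cell s u) (P' : E.Cell s' u') (Q : E.Cell t v) (Q' : E.Cell t' v')
    (h₁ : E.tgt P = E.src A') (h₂ : E.tgt A = E.src P') (h₃ : E.tgt Q = E.src A'')
    (h₄ : E.tgt A' = E.src Q') (h₅ : E.tgt P = E.src Q) (h₆ : E.tgt P' = E.src Q')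
    (e : gcell γ ≫ᵥ E.hcomp P A' h₁ = E.hcomp A P' h₂ ≫ᵥ gcell γ')
    (e' : gcell δ ≫ᵥ E.hcomp Q A'' h₃ = E.hcomp A' Q' h₄ ≫ᵥ gcell δ') :
    gcell (oplaxPaste γ δ) ≫ᵥ E.hcomp (E.hcomp P Q h₅) A'' (by simpa using h₃) =
      E.hcomp A (E.hcomp P' Q' h₆) (by simpa using h₂) ≫ᵥ gcell (oplaxPaste γ' δ') := by
  refine square_comp (assocInv_naturality A P' Q' h₂ h₆).symm ?_
  refine square_comp (whiskerR_square γ γ' _ (by simpa using h₄) e) ?_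
  refine square_comp (E.assoc_naturality P A' Q' h₁ h₄).symm ?_
  refine square_comp (whiskerL_square δ δ' _ (by simpa using h₅) e') ?_
  exact (assocInv_naturality P Q A'' h₅ h₃).symm

theorem laxPaste_square {a b a' b' a'' b'' : E.Obj} {f : E.Pro a b} {f' : E.Pro a' b'}
    {f'' : E.Pro a'' b''} {s : E.Pro a a'} {s' : E.Pro b b'} {t : E.Pro a' a''}
    {t' : E.Pro b' b''}
    {c d c' d' c'' d'' : E.Obj} {g : E.Pro c d} {g' : E.Pro c' d'}
    {g'' : E.Pro c'' d''} {u : E.Pro c c'} {u' : E.Pro d d'} {v : E.Pro c' c''}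
    {v' : E.Pro d' d''}
    (γ : s ⊙ₚ f' ⟶ f ⊙ₚ s') (δ : t ⊙ₚ f'' ⟶ f' ⊙ₚ t')
    (γ' : u ⊙ₚ g' ⟶ g ⊙ₚ u') (δ' : v ⊙ₚ g'' ⟶ g' ⊙ₚ v')
    (A : E.Cell f g) (A' : E.Cell f' g') (A'' : E.Cell f'' g'')
    (P : E.Cell s u) (P' : E.Cell s' u') (Q : E.Cell t v) (Q' : E.Cell t' v')
    (h₁ : E.tgt P = E.src A') (h₂ : E.tgt A = E.src P') (h₃ : E.tgt Q = E.src A'')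
    (h₄ : E.tgt A' = E.src Q') (h₅ : E.tgt P = E.src Q) (h₆ : E.tgt P' = E.src Q')
    (e : gcell γ ≫ᵥ E.hcomp A P' h₂ = E.hcomp P A' h₁ ≫ᵥ gcell γ')
    (e' : gcell δ ≫ᵥ E.hcomp A' Q' h₄ = E.hcomp Q A'' h₃ ≫ᵥ gcell δ') :
    gcell (laxPaste γ δ) ≫ᵥ E.hcomp A (E.hcomp P' Q' h₆) (by simpa using h₂) =
      E.hcomp (E.hcomp P Q h₅) A'' (by simpa using h₃) ≫ᵥ gcell (laxPaste γ' δ') := by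
  refine square_comp (E.assoc_naturality P Q A'' h₅ h₃).symm ?_
  refine square_comp (whiskerL_square δ δ' _ (by simpa using h₁) e') ?_
  refine square_comp (assocInv_naturality P A' Q' h₁ h₄).symm ?_
  refine square_comp (whiskerR_square γ γ' _ (by simpa using h₆) e) ?_
  exact (E.assoc_naturality A P' Q' h₂ h₆).symm

theorem oplaxUnit_square {x y x' y' : E.Obj} {m : E.Pro x y} {m' : E.Pro x' y'} (γ : E.Cell m m')
    (f : x ⟶ x') (g : y ⟶ y') (hf : E.tgt (E.idCell f) = E.src γ)
    (hg : E.tgt γ = E.src (E.idCell g)) :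
    gcell ((rightU m).hom ≫ (leftU m).inv) ≫ᵥ E.hcomp (E.idCell f) γ hf =
      E.hcomp γ (E.idCell g) hg ≫ᵥ gcell ((rightU m').hom ≫ (leftU m').inv) :=
  square_comp (E.right_naturality g γ hg).symm (leftInv_naturality f γ hf).symm

theorem laxUnit_square {x y x' y' : E.Obj} {m : E.Pro x y} {m' : E.Pro x' y'} (γ : E.Cell m m')
    (f : x ⟶ x') (g : y ⟶ y') (hf : E.tgt (E.idCell f) = E.src γ)
    (hg : E.tgt γ = E.src (E.idCell g)) :
    gcell ((leftU m).hom ≫ (rightU m).inv) ≫ᵥ E.hcomp γ (E.idCell g) hg =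
      E.hcomp (E.idCell f) γ hf ≫ᵥ gcell ((leftU m').hom ≫ (rightU m').inv) :=
  square_comp (E.left_naturality f γ hf).symm (rightInv_naturality g γ hg).symm

namespace OplaxProtransformation

/-- The identity oplax protransformation. -/
def id (F : LaxFunctor D E) : OplaxProtransformation F F where
  app x := E.idPro (F.base.obj x)
  arr f := E.idCell (F.base.map f)
  src_arr f := by simp
  tgt_arr f := by simp
  nat m := (rightU (F.pro m)).hom ≫ (leftU (F.pro m)).inv
  arr_id x := by simp
  arr_comp f g := by rw [F.base.map_comp, E.idCell_comp]
  nat_cell γ := oplaxUnit_square _ _ _ _ _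
  nat_pcomp m n := bOplaxId_comp (B := E.Loose) (F.laxComp m n)
  nat_idPro x := bOplaxId_id (B := E.Loose) (F.laxId x)

/-- Composition of oplax protransformations. -/
def comp {F G H : LaxFunctor D E} (σ : OplaxProtransformation F G)
    (τ : OplaxProtransformation G H) : OplaxProtransformation F H where
  app x := σ.app x ⊙ₚ τ.app x
  arr f := E.hcomp (σ.arr f) (τ.arr f) (by simp)
  src_arr f := by simp
  tgt_arr f := by simp
  nat m := oplaxPaste (σ.nat m) (τ.nat m)
  arr_id x := by simp
  arr_comp f g := by
    rw [← E.interchange]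
    exact hcomp_congr (σ.arr_comp f g) (τ.arr_comp f g) _ _
  nat_cell {_ _ _ _ m n} γ :=
    oplaxPaste_square (σ.nat m) (τ.nat m) (σ.nat n) (τ.nat n) (F.cell γ) (G.cell γ) (H.cell γ)
      (σ.arr (D.src γ)) (σ.arr (D.tgt γ)) (τ.arr (D.src γ)) (τ.arr (D.tgt γ))
      (by simp) (by simp) (by simp) (by simp) (by simp) (by simp) (σ.nat_cell γ) (τ.nat_cell γ)
  nat_pcomp m n :=
    bOplaxPaste_comp (B := E.Loose) (F.laxComp m n) (G.laxComp m n) (H.laxComp m n)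
      (σ.nat m) (σ.nat n) (σ.nat (m ⊙ₚ n)) (τ.nat m) (τ.nat n) (τ.nat (m ⊙ₚ n))
      (σ.nat_pcomp m n) (τ.nat_pcomp m n)
  nat_idPro x :=
    bOplaxPaste_id (B := E.Loose) (F.laxId x) (G.laxId x) (H.laxId x)
      (σ.nat (D.idPro x)) (τ.nat (D.idPro x)) (σ.nat_idPro x) (τ.nat_idPro x)

end OplaxProtransformation

namespace LaxProtransformation

/-- The identity lax protransformation. -/
def id (F : LaxFunctor D E) : LaxProtransformation F F where
  app x := E.idPro (F.base.obj x)
  arr f := E.idCell (F.base.map f)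
  src_arr f := by simp
  tgt_arr f := by simp
  nat m := (leftU (F.pro m)).hom ≫ (rightU (F.pro m)).inv
  arr_id x := by simp
  arr_comp f g := by rw [F.base.map_comp, E.idCell_comp]
  nat_cell γ := laxUnit_square _ _ _ _ _
  nat_pcomp m n := bLaxId_comp (B := E.Loose) (F.laxComp m n)
  nat_idPro x := bLaxId_id (B := E.Loose) (F.laxId x)

/-- Composition of lax protransformations. -/
def comp {F G H : LaxFunctor D E} (σ : LaxProtransformation F G)
    (τ : LaxProtransformation G H) : LaxProtransformation F H where
  app x := σ.app x ⊙ₚ τ.app x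
  arr f := E.hcomp (σ.arr f) (τ.arr f) (by simp)
  src_arr f := by simp
  tgt_arr f := by simp
  nat m := laxPaste (σ.nat m) (τ.nat m)
  arr_id x := by simp
  arr_comp f g := by
    rw [← E.interchange]
    exact hcomp_congr (σ.arr_comp f g) (τ.arr_comp f g) _ _
  nat_cell {_ _ _ _ m n} γ :=
    laxPaste_square (σ.nat m) (τ.nat m) (σ.nat n) (τ.nat n) (F.cell γ) (G.cell γ) (H.cell γ)
      (σ.arr (D.src γ)) (σ.arr (D.tgt γ)) (τ.arr (D.src γ)) (τ.arr (D.tgt γ))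
      (by simp) (by simp) (by simp) (by simp) (by simp) (by simp) (σ.nat_cell γ) (τ.nat_cell γ)
  nat_pcomp m n :=
    bLaxPaste_comp (B := E.Loose) (F.laxComp m n) (G.laxComp m n) (H.laxComp m n)
      (σ.nat m) (σ.nat n) (σ.nat (m ⊙ₚ n)) (τ.nat m) (τ.nat n) (τ.nat (m ⊙ₚ n))
      (σ.nat_pcomp m n) (τ.nat_pcomp m n)
  nat_idPro x :=
    bLaxPaste_id (B := E.Loose) (F.laxId x) (G.laxId x) (H.laxId x)
      (σ.nat (D.idPro x)) (τ.nat (D.idPro x)) (σ.nat_idPro x) (τ.nat_idPro x)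

end LaxProtransformation

namespace OplaxModification

/-- A modification from globular components. -/
def ofGlob {F G : LaxFunctor D E} {σ τ : OplaxProtransformation F G}
    (θ : ∀ x, σ.app x ⟶ τ.app x)
    (h : ∀ {x y : D.Obj} (f : x ⟶ y), gcell (θ x) ≫ᵥ τ.arr f = σ.arr f ≫ᵥ gcell (θ y))
    (h' : ∀ {x y : D.Obj} (m : D.Pro x y),
      σ.nat m ≫ whiskerR (θ x) (G.pro m) = whiskerL (F.pro m) (θ y) ≫ τ.nat m) :
    OplaxModification σ τ where
  left := 𝟙 F
  right := 𝟙 G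
  app x := gcell (θ x)
  src_app x := by simp
  tgt_app x := by simp
  app_arr f := h f
  app_nat m := congrArg gcell (h' m)

/-- A modification from the inverses of globular invertible components. -/
def ofGlobInv {F G : LaxFunctor D E} {σ τ : OplaxProtransformation F G}
    (θ : ∀ x, σ.app x ≅ τ.app x)
    (h : ∀ {x y : D.Obj} (f : x ⟶ y),
      gcell (θ x).hom ≫ᵥ τ.arr f = σ.arr f ≫ᵥ gcell (θ y).hom)
    (h' : ∀ {x y : D.Obj} (m : D.Pro x y),
      σ.nat m ≫ whiskerR (θ x).hom (G.pro m) = whiskerL (F.pro m) (θ y).hom ≫ τ.nat m) :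
    OplaxModification τ σ :=
  ofGlob (fun x => (θ x).inv)
    (fun {x y} f => by
      refine (inv_square (congrArg gcell (θ x).inv_hom_id) (congrArg gcell (θ y).hom_inv_id)
        (h f).symm).symm)
    (fun {x y} m => by
      have e := h' m
      have e₁ : whiskerL (F.pro m) (θ y).inv ≫ whiskerL (F.pro m) (θ y).hom = 𝟙 _ := by
        rw [← whiskerL_comp, (θ y).inv_hom_id, whiskerL_id]
      have e₂ : whiskerR (θ x).hom (G.pro m) ≫ whiskerR (θ x).inv (G.pro m) = 𝟙 _ := by
        rw [← whiskerR_comp, (θ x).hom_inv_id, whiskerR_id]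
      calc τ.nat m ≫ whiskerR (θ x).inv (G.pro m)
          = (whiskerL (F.pro m) (θ y).inv ≫ whiskerL (F.pro m) (θ y).hom) ≫ τ.nat m ≫
              whiskerR (θ x).inv (G.pro m) := by rw [e₁, Category.id_comp]
        _ = whiskerL (F.pro m) (θ y).inv ≫ (whiskerL (F.pro m) (θ y).hom ≫ τ.nat m) ≫
              whiskerR (θ x).inv (G.pro m) := by simp only [Category.assoc]
        _ = whiskerL (F.pro m) (θ y).inv ≫ σ.nat m ≫
              (whiskerR (θ x).hom (G.pro m) ≫ whiskerR (θ x).inv (G.pro m)) := by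
            rw [← e]; simp only [Category.assoc]
        _ = _ := by rw [e₂, Category.comp_id])

/-- The identity modification. -/
def one {F G : LaxFunctor D E} (σ : OplaxProtransformation F G) : OplaxModification σ σ :=
  ofGlob (fun x => 𝟙 (σ.app x)) (fun f => by simp)
    (fun m => by rw [whiskerR_id, whiskerL_id, Category.comp_id, Category.id_comp])

/-- Internal composition of modifications. -/
def comp {F G H K L M : LaxFunctor D E} {σ : OplaxProtransformation F G}
    {τ : OplaxProtransformation H K} {ρ : OplaxProtransformation L M}
    (μ : OplaxModification σ τ) (ν : OplaxModification τ ρ) : OplaxModification σ ρ where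
  left := μ.left ≫ ν.left
  right := μ.right ≫ ν.right
  app x := μ.app x ≫ᵥ ν.app x
  src_app x := by simp
  tgt_app x := by simp
  app_arr f := by rw [E.comp_assoc, ν.app_arr, ← E.comp_assoc, μ.app_arr, E.comp_assoc]
  app_nat {x y} m := by
    have e₁ := E.interchange (μ.app x) (ν.app x) (tcell μ.right m) (tcell ν.right m)
      (by simp) (by simp)
    have e₂ := E.interchange (tcell μ.left m) (tcell ν.left m) (μ.app y) (ν.app y)
      (by simp) (by simp)
    refine (congrArg _ e₁).trans (Eq.trans ?_ (congrArg (fun γ => γ ≫ᵥ _) e₂.symm))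
    rw [← E.comp_assoc, μ.app_nat, E.comp_assoc, ν.app_nat, E.comp_assoc]

/-- External composition of modifications. -/
def hcomp {F G H F' G' H' : LaxFunctor D E} {σ : OplaxProtransformation F G}
    {τ : OplaxProtransformation G H} {σ' : OplaxProtransformation F' G'}
    {τ' : OplaxProtransformation G' H'} (μ : OplaxModification σ σ') (ν : OplaxModification τ τ')
    (h : μ.right = ν.left) : OplaxModification (σ.comp τ) (σ'.comp τ') where
  left := μ.left
  right := ν.right
  app x := E.hcomp (μ.app x) (ν.app x) (by simp [h])
  src_app x := (E.src_hcomp _ _ _).trans (μ.src_app x)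
  tgt_app x := (E.tgt_hcomp _ _ _).trans (ν.tgt_app x)
  app_arr {x y} f := by
    refine (E.interchange _ _ _ _ _ _).symm.trans (Eq.trans ?_ (E.interchange _ _ _ _ _ _))
    exact hcomp_congr (μ.app_arr f) (ν.app_arr f) _ _
  app_nat {x y} m :=
    oplaxPaste_square (σ.nat m) (τ.nat m) (σ'.nat m) (τ'.nat m)
      (tcell μ.left m) (tcell μ.right m) (tcell ν.right m) (μ.app x) (μ.app y) (ν.app x) (ν.app y)
      (by simp) (by simp) (by simp) (by simp [h]) (by simp [h]) (by simp [h]) (μ.app_nat m)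
      ((ν.app_nat m).trans (congrArg (fun γ => γ ≫ᵥ _)
        (hcomp_congr (congrArg (fun β => tcell β m) h.symm) rfl _ _)))

/-- The external identity modification on a natural transformation. -/
def idCell {F G : LaxFunctor D E} (α : F ⟶ G) :
    OplaxModification (OplaxProtransformation.id F) (OplaxProtransformation.id G) where
  left := α
  right := α
  app x := E.idCell (tapp α x)
  src_app x := E.src_idCell _
  tgt_app x := E.tgt_idCell _
  app_arr f := by
    refine (E.idCell_comp _ _).symm.trans (Eq.trans ?_ (E.idCell_comp _ _))
    rw [tapp_naturality]
  app_nat m := oplaxUnit_square _ _ _ _ _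

end OplaxModification

/-- The double category `LaxOpl(D, E)` of lax double functors, natural transformations, oplax
protransformations, and modifications. -/
def LaxOpl (D : DoubleCategory.{u₁, v₁, w₁, r₁}) (E : DoubleCategory.{u₂, v₂, w₂, r₂}) :
    DoubleCategory where
  Obj := LaxFunctor D E
  Pro F G := OplaxProtransformation F G
  Cell σ τ := OplaxModification σ τ
  src μ := μ.left
  tgt μ := μ.right
  one σ := OplaxModification.one σ
  comp μ ν := μ.comp ν
  src_one _ := rfl
  tgt_one _ := rfl
  src_comp _ _ := rfl
  tgt_comp _ _ := rfl
  one_comp μ := OplaxModification.ext (Category.id_comp _) (Category.id_comp _)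
    (funext fun _ => E.one_comp _)
  comp_one μ := OplaxModification.ext (Category.comp_id _) (Category.comp_id _)
    (funext fun _ => E.comp_one _)
  comp_assoc μ ν ρ := OplaxModification.ext (Category.assoc _ _ _) (Category.assoc _ _ _)
    (funext fun _ => E.comp_assoc _ _ _)
  idPro F := OplaxProtransformation.id F
  idCell α := OplaxModification.idCell α
  src_idCell _ := rfl
  tgt_idCell _ := rfl
  idCell_id F := OplaxModification.ext rfl rfl (funext fun _ => E.idCell_id _)
  idCell_comp α β := OplaxModification.ext rfl rfl (funext fun _ => E.idCell_comp _ _)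
  pcomp σ τ := σ.comp τ
  hcomp μ ν h := μ.hcomp ν h
  src_hcomp _ _ _ := rfl
  tgt_hcomp _ _ _ := rfl
  hcomp_one σ τ := OplaxModification.ext rfl rfl (funext fun _ => E.hcomp_one _ _)
  interchange μ μ' ν ν' h h' := OplaxModification.ext rfl rfl
    (funext fun _ => E.interchange _ _ _ _ _ _)
  assocHom σ τ ρ := OplaxModification.ofGlob
    (fun x => (assoc (σ.app x) (τ.app x) (ρ.app x)).hom)
    (fun f => (E.assoc_naturality (σ.arr f) (τ.arr f) (ρ.arr f) (by simp) (by simp)).symm)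
    (fun m => bOplaxPaste_assoc (B := E.Loose) (σ.nat m) (τ.nat m) (ρ.nat m))
  assocInv σ τ ρ := OplaxModification.ofGlobInv
    (fun x => assoc (σ.app x) (τ.app x) (ρ.app x))
    (fun f => (E.assoc_naturality (σ.arr f) (τ.arr f) (ρ.arr f) (by simp) (by simp)).symm)
    (fun m => bOplaxPaste_assoc (B := E.Loose) (σ.nat m) (τ.nat m) (ρ.nat m))
  assoc_hom_inv σ τ ρ := OplaxModification.ext (Category.id_comp _) (Category.id_comp _)
    (funext fun _ => E.assoc_hom_inv _ _ _)
  assoc_inv_hom σ τ ρ := OplaxModification.ext (Category.id_comp _) (Category.id_comp _)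
    (funext fun _ => E.assoc_inv_hom _ _ _)
  src_assocHom _ _ _ := rfl
  tgt_assocHom _ _ _ := rfl
  assoc_naturality μ ν ρ h h' := OplaxModification.ext
    ((Category.comp_id _).trans (Category.id_comp _).symm)
    ((Category.comp_id _).trans (Category.id_comp _).symm)
    (funext fun _ => E.assoc_naturality _ _ _ _ _)
  leftHom σ := OplaxModification.ofGlob (fun x => (leftU (σ.app x)).hom)
    (fun f => (E.left_naturality _ (σ.arr f) (by simp)).symm)
    (fun m => bOplaxPaste_left (B := E.Loose) (σ.nat m))
  leftInv σ := OplaxModification.ofGlobInv (fun x => leftU (σ.app x))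
    (fun f => (E.left_naturality _ (σ.arr f) (by simp)).symm)
    (fun m => bOplaxPaste_left (B := E.Loose) (σ.nat m))
  left_hom_inv σ := OplaxModification.ext (Category.id_comp _) (Category.id_comp _)
    (funext fun _ => E.left_hom_inv _)
  left_inv_hom σ := OplaxModification.ext (Category.id_comp _) (Category.id_comp _)
    (funext fun _ => E.left_inv_hom _)
  src_leftHom _ := rfl
  tgt_leftHom _ := rfl
  left_naturality α μ h := OplaxModification.ext
    ((Category.comp_id _).trans (h.trans (Category.id_comp _).symm))
    ((Category.comp_id _).trans (Category.id_comp _).symm)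
    (funext fun _ => E.left_naturality _ _ _)
  rightHom σ := OplaxModification.ofGlob (fun x => (rightU (σ.app x)).hom)
    (fun f => (E.right_naturality _ (σ.arr f) (by simp)).symm)
    (fun m => bOplaxPaste_right (B := E.Loose) (σ.nat m))
  rightInv σ := OplaxModification.ofGlobInv (fun x => rightU (σ.app x))
    (fun f => (E.right_naturality _ (σ.arr f) (by simp)).symm)
    (fun m => bOplaxPaste_right (B := E.Loose) (σ.nat m))
  right_hom_inv σ := OplaxModification.ext (Category.id_comp _) (Category.id_comp _)
    (funext fun _ => E.right_hom_inv _)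
  right_inv_hom σ := OplaxModification.ext (Category.id_comp _) (Category.id_comp _)
    (funext fun _ => E.right_inv_hom _)
  src_rightHom _ := rfl
  tgt_rightHom _ := rfl
  right_naturality α μ h := OplaxModification.ext
    ((Category.comp_id _).trans (Category.id_comp _).symm)
    ((Category.comp_id _).trans (h.symm.trans (Category.id_comp _).symm))
    (funext fun _ => E.right_naturality _ _ _)
  pentagon σ τ ρ υ := OplaxModification.ext (Category.id_comp _) (Category.id_comp _)
    (funext fun _ => E.pentagon _ _ _ _)
  triangle σ τ := OplaxModification.ext (Category.id_comp _) (Category.id_comp _)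
    (funext fun _ => E.triangle _ _)

/-! ### The double category of lax protransformations -/

namespace LaxModification

/-- A modification from globular components. -/
def ofGlob {F G : LaxFunctor D E} {σ τ : LaxProtransformation F G}
    (θ : ∀ x, σ.app x ⟶ τ.app x)
    (h : ∀ {x y : D.Obj} (f : x ⟶ y), gcell (θ x) ≫ᵥ τ.arr f = σ.arr f ≫ᵥ gcell (θ y))
    (h' : ∀ {x y : D.Obj} (m : D.Pro x y),
      σ.nat m ≫ whiskerL (F.pro m) (θ y) = whiskerR (θ x) (G.pro m) ≫ τ.nat m) :
    LaxModification σ τ where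
  left := 𝟙 F
  right := 𝟙 G
  app x := gcell (θ x)
  src_app x := by simp
  tgt_app x := by simp
  app_arr f := h f
  app_nat m := congrArg gcell (h' m)

/-- A modification from the inverses of globular invertible components. -/
def ofGlobInv {F G : LaxFunctor D E} {σ τ : LaxProtransformation F G}
    (θ : ∀ x, σ.app x ≅ τ.app x)
    (h : ∀ {x y : D.Obj} (f : x ⟶ y),
      gcell (θ x).hom ≫ᵥ τ.arr f = σ.arr f ≫ᵥ gcell (θ y).hom)
    (h' : ∀ {x y : D.Obj} (m : D.Pro x y),
      σ.nat m ≫ whiskerL (F.pro m) (θ y).hom = whiskerR (θ x).hom (G.pro m) ≫ τ.nat m) :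
    LaxModification τ σ :=
  ofGlob (fun x => (θ x).inv)
    (fun {x y} f => by
      refine (inv_square (congrArg gcell (θ x).inv_hom_id) (congrArg gcell (θ y).hom_inv_id)
        (h f).symm).symm)
    (fun {x y} m => by
      have e := h' m
      have e₁ : whiskerR (θ x).inv (G.pro m) ≫ whiskerR (θ x).hom (G.pro m) = 𝟙 _ := by
        rw [← whiskerR_comp, (θ x).inv_hom_id, whiskerR_id]
      have e₂ : whiskerL (F.pro m) (θ y).hom ≫ whiskerL (F.pro m) (θ y).inv = 𝟙 _ := by
        rw [← whiskerL_comp, (θ y).hom_inv_id, whiskerL_id]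
      calc τ.nat m ≫ whiskerL (F.pro m) (θ y).inv
          = (whiskerR (θ x).inv (G.pro m) ≫ whiskerR (θ x).hom (G.pro m)) ≫ τ.nat m ≫
              whiskerL (F.pro m) (θ y).inv := by rw [e₁, Category.id_comp]
        _ = whiskerR (θ x).inv (G.pro m) ≫ (whiskerR (θ x).hom (G.pro m) ≫ τ.nat m) ≫
              whiskerL (F.pro m) (θ y).inv := by simp only [Category.assoc]
        _ = whiskerR (θ x).inv (G.pro m) ≫ σ.nat m ≫
              (whiskerL (F.pro m) (θ y).hom ≫ whiskerL (F.pro m) (θ y).inv) := by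
            rw [← e]; simp only [Category.assoc]
        _ = _ := by rw [e₂, Category.comp_id])

/-- The identity modification. -/
def one {F G : LaxFunctor D E} (σ : LaxProtransformation F G) : LaxModification σ σ :=
  ofGlob (fun x => 𝟙 (σ.app x)) (fun f => by simp)
    (fun m => by rw [whiskerL_id, whiskerR_id, Category.comp_id, Category.id_comp])

/-- Internal composition of modifications. -/
def comp {F G H K L M : LaxFunctor D E} {σ : LaxProtransformation F G}
    {τ : LaxProtransformation H K} {ρ : LaxProtransformation L M}
    (μ : LaxModification σ τ) (ν : LaxModification τ ρ) : LaxModification σ ρ where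
  left := μ.left ≫ ν.left
  right := μ.right ≫ ν.right
  app x := μ.app x ≫ᵥ ν.app x
  src_app x := by simp
  tgt_app x := by simp
  app_arr f := by rw [E.comp_assoc, ν.app_arr, ← E.comp_assoc, μ.app_arr, E.comp_assoc]
  app_nat {x y} m := by
    have e₁ := E.interchange (μ.app x) (ν.app x) (tcell μ.right m) (tcell ν.right m)
      (by simp) (by simp)
    have e₂ := E.interchange (tcell μ.left m) (tcell ν.left m) (μ.app y) (ν.app y)
      (by simp) (by simp)
    refine (congrArg _ e₂).trans (Eq.trans ?_ (congrArg (fun γ => γ ≫ᵥ _) e₁.symm))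
    rw [← E.comp_assoc, μ.app_nat, E.comp_assoc, ν.app_nat, E.comp_assoc]

/-- External composition of modifications. -/
def hcomp {F G H F' G' H' : LaxFunctor D E} {σ : LaxProtransformation F G}
    {τ : LaxProtransformation G H} {σ' : LaxProtransformation F' G'}
    {τ' : LaxProtransformation G' H'} (μ : LaxModification σ σ') (ν : LaxModification τ τ')
    (h : μ.right = ν.left) : LaxModification (σ.comp τ) (σ'.comp τ') where
  left := μ.left
  right := ν.right
  app x := E.hcomp (μ.app x) (ν.app x) (by simp [h])
  src_app x := (E.src_hcomp _ _ _).trans (μ.src_app x)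
  tgt_app x := (E.tgt_hcomp _ _ _).trans (ν.tgt_app x)
  app_arr {x y} f := by
    refine (E.interchange _ _ _ _ _ _).symm.trans (Eq.trans ?_ (E.interchange _ _ _ _ _ _))
    exact hcomp_congr (μ.app_arr f) (ν.app_arr f) _ _
  app_nat {x y} m :=
    laxPaste_square (σ.nat m) (τ.nat m) (σ'.nat m) (τ'.nat m)
      (tcell μ.left m) (tcell μ.right m) (tcell ν.right m) (μ.app x) (μ.app y) (ν.app x) (ν.app y)
      (by simp) (by simp) (by simp) (by simp [h]) (by simp [h]) (by simp [h]) (μ.app_nat m)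
      ((congrArg (fun γ => _ ≫ᵥ γ)
        (hcomp_congr (congrArg (fun β => tcell β m) h) rfl _ _)).trans (ν.app_nat m))

/-- The external identity modification on a natural transformation. -/
def idCell {F G : LaxFunctor D E} (α : F ⟶ G) :
    LaxModification (LaxProtransformation.id F) (LaxProtransformation.id G) where
  left := α
  right := α
  app x := E.idCell (tapp α x)
  src_app x := E.src_idCell _
  tgt_app x := E.tgt_idCell _
  app_arr f := by
    refine (E.idCell_comp _ _).symm.trans (Eq.trans ?_ (E.idCell_comp _ _))
    rw [tapp_naturality]
  app_nat m := laxUnit_square _ _ _ _ _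

end LaxModification

/-- The double category `LaxLax(D, E)` of lax double functors, natural transformations, lax
protransformations, and modifications. -/
def LaxLax (D : DoubleCategory.{u₁, v₁, w₁, r₁}) (E : DoubleCategory.{u₂, v₂, w₂, r₂}) :
    DoubleCategory where
  Obj := LaxFunctor D E
  Pro F G := LaxProtransformation F G
  Cell σ τ := LaxModification σ τ
  src μ := μ.left
  tgt μ := μ.right
  one σ := LaxModification.one σ
  comp μ ν := μ.comp ν
  src_one _ := rfl
  tgt_one _ := rfl
  src_comp _ _ := rfl
  tgt_comp _ _ := rfl
  one_comp μ := LaxModification.ext (Category.id_comp _) (Category.id_comp _)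
    (funext fun _ => E.one_comp _)
  comp_one μ := LaxModification.ext (Category.comp_id _) (Category.comp_id _)
    (funext fun _ => E.comp_one _)
  comp_assoc μ ν ρ := LaxModification.ext (Category.assoc _ _ _) (Category.assoc _ _ _)
    (funext fun _ => E.comp_assoc _ _ _)
  idPro F := LaxProtransformation.id F
  idCell α := LaxModification.idCell α
  src_idCell _ := rfl
  tgt_idCell _ := rfl
  idCell_id F := LaxModification.ext rfl rfl (funext fun _ => E.idCell_id _)
  idCell_comp α β := LaxModification.ext rfl rfl (funext fun _ => E.idCell_comp _ _)
  pcomp σ τ := σ.comp τ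
  hcomp μ ν h := μ.hcomp ν h
  src_hcomp _ _ _ := rfl
  tgt_hcomp _ _ _ := rfl
  hcomp_one σ τ := LaxModification.ext rfl rfl (funext fun _ => E.hcomp_one _ _)
  interchange μ μ' ν ν' h h' := LaxModification.ext rfl rfl
    (funext fun _ => E.interchange _ _ _ _ _ _)
  assocHom σ τ ρ := LaxModification.ofGlob
    (fun x => (assoc (σ.app x) (τ.app x) (ρ.app x)).hom)
    (fun f => (E.assoc_naturality (σ.arr f) (τ.arr f) (ρ.arr f) (by simp) (by simp)).symm)
    (fun m => bLaxPaste_assoc (B := E.Loose) (σ.nat m) (τ.nat m) (ρ.nat m))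
  assocInv σ τ ρ := LaxModification.ofGlobInv
    (fun x => assoc (σ.app x) (τ.app x) (ρ.app x))
    (fun f => (E.assoc_naturality (σ.arr f) (τ.arr f) (ρ.arr f) (by simp) (by simp)).symm)
    (fun m => bLaxPaste_assoc (B := E.Loose) (σ.nat m) (τ.nat m) (ρ.nat m))
  assoc_hom_inv σ τ ρ := LaxModification.ext (Category.id_comp _) (Category.id_comp _)
    (funext fun _ => E.assoc_hom_inv _ _ _)
  assoc_inv_hom σ τ ρ := LaxModification.ext (Category.id_comp _) (Category.id_comp _)
    (funext fun _ => E.assoc_inv_hom _ _ _)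
  src_assocHom _ _ _ := rfl
  tgt_assocHom _ _ _ := rfl
  assoc_naturality μ ν ρ h h' := LaxModification.ext
    ((Category.comp_id _).trans (Category.id_comp _).symm)
    ((Category.comp_id _).trans (Category.id_comp _).symm)
    (funext fun _ => E.assoc_naturality _ _ _ _ _)
  leftHom σ := LaxModification.ofGlob (fun x => (leftU (σ.app x)).hom)
    (fun f => (E.left_naturality _ (σ.arr f) (by simp)).symm)
    (fun m => bLaxPaste_left (B := E.Loose) (σ.nat m))
  leftInv σ := LaxModification.ofGlobInv (fun x => leftU (σ.app x))
    (fun f => (E.left_naturality _ (σ.arr f) (by simp)).symm)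
    (fun m => bLaxPaste_left (B := E.Loose) (σ.nat m))
  left_hom_inv σ := LaxModification.ext (Category.id_comp _) (Category.id_comp _)
    (funext fun _ => E.left_hom_inv _)
  left_inv_hom σ := LaxModification.ext (Category.id_comp _) (Category.id_comp _)
    (funext fun _ => E.left_inv_hom _)
  src_leftHom _ := rfl
  tgt_leftHom _ := rfl
  left_naturality α μ h := LaxModification.ext
    ((Category.comp_id _).trans (h.trans (Category.id_comp _).symm))
    ((Category.comp_id _).trans (Category.id_comp _).symm)
    (funext fun _ => E.left_naturality _ _ _)
  rightHom σ := LaxModification.ofGlob (fun x => (rightU (σ.app x)).hom)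
    (fun f => (E.right_naturality _ (σ.arr f) (by simp)).symm)
    (fun m => bLaxPaste_right (B := E.Loose) (σ.nat m))
  rightInv σ := LaxModification.ofGlobInv (fun x => rightU (σ.app x))
    (fun f => (E.right_naturality _ (σ.arr f) (by simp)).symm)
    (fun m => bLaxPaste_right (B := E.Loose) (σ.nat m))
  right_hom_inv σ := LaxModification.ext (Category.id_comp _) (Category.id_comp _)
    (funext fun _ => E.right_hom_inv _)
  right_inv_hom σ := LaxModification.ext (Category.id_comp _) (Category.id_comp _)
    (funext fun _ => E.right_inv_hom _)
  src_rightHom _ := rfl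
  tgt_rightHom _ := rfl
  right_naturality α μ h := LaxModification.ext
    ((Category.comp_id _).trans (Category.id_comp _).symm)
    ((Category.comp_id _).trans (h.symm.trans (Category.id_comp _).symm))
    (funext fun _ => E.right_naturality _ _ _)
  pentagon σ τ ρ υ := LaxModification.ext (Category.id_comp _) (Category.id_comp _)
    (funext fun _ => E.pentagon _ _ _ _)
  triangle σ τ := LaxModification.ext (Category.id_comp _) (Category.id_comp _)
    (funext fun _ => E.triangle _ _)

end Transformations

end Dbl

/-! ### Coherence of the unitors. -/

namespace Dbl

namespace DoubleCategory

variable {E : DoubleCategory.{u, v, w, r}}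

/-! Modifications compose componentwise, and the structural cells of the functor double categories
are those of `E` componentwise. Evaluation at an object `x` therefore carries a companion of `α` to
a companion of `α_x`, which is the easy direction.

For the converse, choose companions `p_x` of the `α_x`, with unit `η_x` and counit `ε_x`. Bending
the sides of `α_m` with `η_x` on the left and `ε_y` on the right gives a globular cell `F m ⊙ p_y ⟶
p_x ⊙ G m` (`mate`). This is the direction of an oplax comparison, and `α_m` need not be invertible.
The naturality squares of `α` at arrows bend in the same way to cells `p_x ⟶ p_y` (`arrowMate`). The
lemmas `unit_mate` and `unit_arrowMate` are exactly the conditions for the `η_x` to form a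
modification, and `mate_counit` and `arrowMate_counit` those for the `ε_x`. The companion equations
then hold because they hold at each object.

What remains is that these cells form a protransformation. The tool is a cancellation property: a
cell out of `m ⊙ p`, with `p` a companion, is determined by its right side and its composite with
`1_m ⊙ η` (`whisker_unit_cancel`; `unit_cancel` is the version without `m`). Composing an axiom with
`η` trades every mate for the cell of `α` it came from. The axiom becomes one for the identity
protransformation of `F`, combined with the corresponding axiom for `α`.

Conjoints are the mirror image: reversing proarrows exchanges companions with conjoints, and oplax
comparisons for `F ⇸ G` with lax ones for `G ⇸ F`. -/

theorem leftHom_idPro (x : E.Obj) : E.leftHom (E.idPro x) = E.rightHom (E.idPro x) :=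
  congrArg (gcell (E := E)) (Bicategory.unitors_equal (B := E.Loose) (a := x))

theorem leftInv_idPro (x : E.Obj) : E.leftInv (E.idPro x) = E.rightInv (E.idPro x) :=
  congrArg (gcell (E := E)) (Bicategory.unitors_inv_equal (B := E.Loose) (a := x))

/-- An instance of bicategorical coherence, read in the bicategory of proarrows and globular cells.
It lets a unit inserted at the end of `m ⊙ p` be absorbed by `p` alone, where the companion equation
applies. -/
theorem rightHom_pcomp {x y z : E.Obj} (m : E.Pro x y) (n : E.Pro y z) :
    E.rightHom (m ⊙ₚ n) =
      E.assocHom m n (E.idPro z) ≫ᵥ E.hcomp (E.one m) (E.rightHom n) (by simp) :=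
  congrArg (gcell (E := E)) (Bicategory.rightUnitor_comp (B := E.Loose) m n)

theorem leftHom_pcomp {x y z : E.Obj} (m : E.Pro x y) (n : E.Pro y z) :
    E.leftHom (m ⊙ₚ n) =
      E.assocInv (E.idPro x) m n ≫ᵥ E.hcomp (E.leftHom m) (E.one n) (by simp) :=
  congrArg (gcell (E := E)) (Bicategory.leftUnitor_comp (B := E.Loose) m n)

/-! ### Companions: cancellation of the unit. -/

namespace CompanionPair

section

variable {x y : E.Obj} {f : x ⟶ y} {p : E.Pro x y} (c : E.CompanionPair f p)

include c

/-- The companion equation with its left unitor carried to the other side, the form in which it is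
used for rewriting. -/
theorem hcomp_comp_rightHom :
    E.hcomp c.unit c.counit (c.tgt_unit.trans c.src_counit.symm) ≫ᵥ E.rightHom p =
      E.leftHom p := by
  have h := congrArg (fun γ => E.leftHom p ≫ᵥ γ) c.unit_hcomp_counit
  simpa only [← E.comp_assoc, E.left_hom_inv, E.one_comp, E.comp_one] using h

/-- Cells out of a companion are determined by their composites with the unit. -/
theorem unit_cancel {x' y' : E.Obj} {k : E.Pro x' y'} {γ δ : E.Cell p k}
    (ht : E.tgt γ = E.tgt δ) (h : c.unit ≫ᵥ γ = c.unit ≫ᵥ δ) : γ = δ := by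
  -- A formula recovering `γ` from `η ⬝ γ` and its right side `v`: by interchange the middle factor
  -- is `(η ⊙ ε) ⬝ (γ ⊙ id_v)`, the right unitor slides past `γ`, and `η ⊙ ε` collapses by the
  -- companion equation.
  have key : ∀ (v : y ⟶ y') (γ : E.Cell p k) (hv : E.tgt γ = v),
      γ = E.leftInv p ≫ᵥ E.hcomp (c.unit ≫ᵥ γ) (c.counit ≫ᵥ E.idCell v)
        (by simp [c.tgt_unit, c.src_counit, hv]) ≫ᵥ E.rightHom k := by
    intro v γ hv
    rw [E.interchange _ _ _ _ (c.tgt_unit.trans c.src_counit.symm) (by simpa using hv),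
      E.comp_assoc, E.right_naturality, ← E.comp_assoc (E.hcomp _ _ _), c.hcomp_comp_rightHom,
      ← E.comp_assoc, E.left_inv_hom, E.one_comp]
  -- Both formulas are taken at `v = tgt δ`, so they differ only in `η ⬝ γ` and `η ⬝ δ`. Equality of
  -- targets must be assumed, since `h` only gives it after composition with `f`.
  refine (key _ γ ht).trans (Eq.trans ?_ (key _ δ rfl).symm)
  simp only [h]

/-- The companion equation whiskered by `m`: reassociating brings `η` next to `ε`, their composite
becomes a left unitor, and the triangle identity turns this into a right unitor on `m`. -/
theorem whisker_unit_hcomp_counit {z : E.Obj} (m : E.Pro z x) :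
    E.hcomp (E.hcomp (E.one m) c.unit (by simp [c.src_unit])) c.counit
        (by simp [c.tgt_unit, c.src_counit]) ≫ᵥ E.rightHom (m ⊙ₚ p) =
      E.hcomp (E.rightHom m) (E.one p) (by simp) := by
  rw [rightHom_pcomp, ← E.comp_assoc, E.assoc_naturality _ _ _ (by simp [c.src_unit])
    (c.tgt_unit.trans c.src_counit.symm), E.comp_assoc, ← E.interchange, ← E.triangle]
  exact congrArg _ (hcomp_congr (E.one_comp _) c.hcomp_comp_rightHom _ _)

/-- Cells out of `m ⊙ p`, with `p` a companion, are determined by their composites with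
`1_m ⊙ η`. -/
theorem whisker_unit_cancel {z x' y' : E.Obj} {m : E.Pro z x} {k : E.Pro x' y'}
    {γ δ : E.Cell (m ⊙ₚ p) k} (ht : E.tgt γ = E.tgt δ)
    (h : E.hcomp (E.one m) c.unit (by simp [c.src_unit]) ≫ᵥ γ =
      E.hcomp (E.one m) c.unit (by simp [c.src_unit]) ≫ᵥ δ) : γ = δ := by
  -- The reconstruction formula of `unit_cancel`, whiskered. The leading factor is the inverse of
  -- `ρ_m ⊙ 1_p`, which is what `whisker_unit_hcomp_counit` leaves behind.
  have key : ∀ (v : y ⟶ y') (γ : E.Cell (m ⊙ₚ p) k) (hv : E.tgt γ = v),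
      γ = E.hcomp (E.rightInv m) (E.one p) (by simp) ≫ᵥ
        E.hcomp (E.hcomp (E.one m) c.unit (by simp [c.src_unit]) ≫ᵥ γ) (c.counit ≫ᵥ E.idCell v)
          (by simp [c.tgt_unit, c.src_counit, hv]) ≫ᵥ E.rightHom k := by
    intro v γ hv
    rw [E.interchange _ _ _ _ (by simp [c.tgt_unit, c.src_counit]) (by simpa using hv),
      E.comp_assoc, E.right_naturality, ← E.comp_assoc (E.hcomp (E.hcomp _ _ _) _ _),
      c.whisker_unit_hcomp_counit, ← E.comp_assoc, ← E.interchange]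
    rw [hcomp_congr (E.right_inv_hom m) (E.one_comp _) _ (by simp), E.hcomp_one, E.one_comp]
  refine (key _ γ ht).trans (Eq.trans ?_ (key _ δ rfl).symm)
  simp only [h]

end

/-! ### Companions: bending a cell into a globular comparison. -/

section Mates

variable {x y x' y' : E.Obj} {f : x ⟶ x'} {g : y ⟶ y'} {q : E.Pro x x'} {p : E.Pro y y'}
  (c : E.CompanionPair f q) (d : E.CompanionPair g p)

/-- The globular cell `m ⊙ p ⟶ q ⊙ n` corresponding to a cell `m ⟶ n` bounded by arrows with
companions `q` and `p`. -/
def mate {m : E.Pro x y} {n : E.Pro x' y'} (γ : E.Cell m n) (hs : E.src γ = f)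
    (ht : E.tgt γ = g) : m ⊙ₚ p ⟶ q ⊙ₚ n :=
  glob (E.leftInv (m ⊙ₚ p) ≫ᵥ
      E.hcomp c.unit (E.hcomp γ d.counit (ht.trans d.src_counit.symm))
        (by simp [c.tgt_unit, hs]) ≫ᵥ
      E.hcomp (E.one q) (E.rightHom n) (by simp))
    (by simp [c.src_unit]) (by simp [d.tgt_counit])

/-- The counit inside the mate meets the new unit, and `η ⬝ ε = id_g` straightens the right side of
`γ`. This is external equivariance of `η`; by `whisker_unit_cancel` it also determines the mate
among globular cells. -/
theorem unit_mate {m : E.Pro x y} {n : E.Pro x' y'} (γ : E.Cell m n) (hs : E.src γ = f)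
    (ht : E.tgt γ = g) :
    gcell ((rightU m).hom ≫ (leftU m).inv) ≫ᵥ E.hcomp c.unit γ (c.tgt_unit.trans hs.symm) =
      E.hcomp (E.one m) d.unit (by simp [d.src_unit]) ≫ᵥ gcell (mate c d γ hs ht) := by
  have h₁ : E.hcomp (E.one m) d.unit (by simp [d.src_unit]) ≫ᵥ
      E.hcomp γ d.counit (ht.trans d.src_counit.symm) ≫ᵥ E.rightHom n = E.rightHom m ≫ᵥ γ := by
    rw [← E.comp_assoc, ← E.interchange, hcomp_congr (E.one_comp γ) d.unit_comp_counit _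
      (by simpa using ht), E.right_naturality]
  have h₂ : gcell (mate c d γ hs ht) = E.leftInv (m ⊙ₚ p) ≫ᵥ E.hcomp c.unit
      (E.hcomp γ d.counit (ht.trans d.src_counit.symm) ≫ᵥ E.rightHom n)
        (by simp [c.tgt_unit, hs]) := by
    refine congrArg _ ((E.interchange _ _ _ _ _ _).symm.trans ?_)
    exact hcomp_congr (E.comp_one _) rfl _ _
  -- Naturality of the inverse left unitor at an identity arrow brings both sides to the form `λ⁻¹ ⬝
  -- (η ⊙ _)`; the right-hand factors then agree by `h₁`.
  rw [h₂, ← E.comp_assoc, leftInv_naturality (𝟙 x) _ (by simp), E.comp_assoc, ← E.interchange,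
    gcell_comp, gcell_rightU_hom, gcell_leftU_inv, leftInv_naturality (𝟙 x) _ (by simp),
    E.comp_assoc, ← E.interchange]
  exact congrArg _ (hcomp_congr rfl h₁.symm _ _)

/-- Here it is the left side that straightens: the unit inside the mate meets the new counit and
gives `id_f`, which the inverse left unitor absorbs. This is external equivariance of `ε`. -/
theorem mate_counit {m : E.Pro x y} {n : E.Pro x' y'} (γ : E.Cell m n) (hs : E.src γ = f)
    (ht : E.tgt γ = g) :
    gcell (mate c d γ hs ht) ≫ᵥ E.hcomp c.counit (E.one n) (by simp [c.tgt_counit]) =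
      E.hcomp γ d.counit (ht.trans d.src_counit.symm) ≫ᵥ
        gcell ((rightU n).hom ≫ (leftU n).inv) := by
  have h : gcell (mate c d γ hs ht) = E.leftInv (m ⊙ₚ p) ≫ᵥ
      E.hcomp c.unit (E.hcomp γ d.counit (ht.trans d.src_counit.symm))
        (by simp [c.tgt_unit, hs]) ≫ᵥ E.hcomp (E.one q) (E.rightHom n) (by simp) := rfl
  rw [h, E.comp_assoc, ← E.interchange, ← E.interchange, gcell_comp, gcell_rightU_hom,
    gcell_leftU_inv, ← E.comp_assoc, leftInv_naturality f _ (by simp [hs])]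
  refine congrArg _ (hcomp_congr ?_ (by simp) _ _)
  rw [E.comp_one, c.unit_comp_counit]

end Mates

/-! ### Companions: functoriality in squares of arrows. -/

section ArrowMates

variable {x y x' y' : E.Obj} {f : x ⟶ x'} {g : y ⟶ y'} {q : E.Pro x x'} {p : E.Pro y y'}
  (c : E.CompanionPair f q) (d : E.CompanionPair g p)
  {s : x ⟶ y} {t : x' ⟶ y'} (h : s ≫ g = f ≫ t)

/-- The cell between companions induced by a commutative square of arrows. -/
def arrowMate : E.Cell q p :=
  E.leftInv q ≫ᵥ E.hcomp (E.idCell s ≫ᵥ d.unit) (c.counit ≫ᵥ E.idCell t)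
    (by simp [d.tgt_unit, c.src_counit, h]) ≫ᵥ E.rightHom p

theorem src_arrowMate : E.src (arrowMate c d h) = s := by
  simp [arrowMate, d.src_unit]

theorem tgt_arrowMate : E.tgt (arrowMate c d h) = t := by
  simp [arrowMate, c.tgt_counit]

theorem unit_arrowMate : c.unit ≫ᵥ arrowMate c d h = E.idCell s ≫ᵥ d.unit := by
  unfold arrowMate
  -- Moved across `λ⁻¹`, the unit enters the right factor and meets the counit there, giving `id_f ⬝
  -- id_t = id_{s ≫ g}`. The right unitor absorbs this cell, and the two unitors left on `id_x`
  -- cancel because they agree there.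
  rw [← E.comp_assoc, leftInv_naturality (𝟙 x) _ (by simp [c.src_unit]), E.comp_assoc,
    ← E.comp_assoc (E.hcomp _ _ _), ← E.interchange,
    hcomp_congr (γ' := E.idCell s ≫ᵥ d.unit) (δ' := E.idCell (s ≫ g)) _ _ _
      (by simp [d.tgt_unit]), E.right_naturality, leftInv_idPro, ← E.comp_assoc,
    E.right_inv_hom, E.one_comp]
  · simp
  · rw [← E.comp_assoc, c.unit_comp_counit, ← E.idCell_comp, h]

theorem arrowMate_counit : arrowMate c d h ≫ᵥ d.counit = c.counit ≫ᵥ E.idCell t := by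
  unfold arrowMate
  -- Now the counit of `d` moves across `ρ` into the left factor and meets its unit, giving `id_{f ≫
  -- t}`. For the left unitor to absorb it, `ρ` on `id_{y'}` is first replaced by `λ`.
  rw [E.comp_assoc, E.comp_assoc, ← E.right_naturality (𝟙 y') _ (by simp [d.tgt_counit]),
    ← E.comp_assoc (E.hcomp _ _ _), ← E.interchange,
    hcomp_congr (γ' := E.idCell (f ≫ t)) (δ' := c.counit ≫ᵥ E.idCell t) _ _ _
      (by simp [c.src_counit]), ← leftHom_idPro, E.left_naturality, ← E.comp_assoc,
    E.left_inv_hom, E.one_comp]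
  · rw [E.comp_assoc, d.unit_comp_counit, ← E.idCell_comp, h]
  · simp

end ArrowMates

end CompanionPair

/-! ### Conjoints: the mirror image, with left and right exchanged. -/

namespace ConjointPair

section

variable {x y : E.Obj} {f : x ⟶ y} {p : E.Pro y x} (c : E.ConjointPair f p)

include c

theorem hcomp_comp_leftHom :
    E.hcomp c.counit c.unit (c.tgt_counit.trans c.src_unit.symm) ≫ᵥ E.leftHom p =
      E.rightHom p := by
  have h := congrArg (fun γ => E.rightHom p ≫ᵥ γ) c.counit_hcomp_unit
  simpa only [← E.comp_assoc, E.right_hom_inv, E.one_comp, E.comp_one] using h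

/-- Cells out of a conjoint are determined by their composites with the unit. -/
theorem unit_cancel {x' y' : E.Obj} {k : E.Pro x' y'} {γ δ : E.Cell p k}
    (hs : E.src γ = E.src δ) (h : c.unit ≫ᵥ γ = c.unit ≫ᵥ δ) : γ = δ := by
  -- For a conjoint the counit stands to the left of the unit, so the side that must be remembered
  -- besides `η ⬝ γ` is the left one.
  have key : ∀ (v : y ⟶ x') (γ : E.Cell p k) (hv : E.src γ = v),
      γ = E.rightInv p ≫ᵥ E.hcomp (c.counit ≫ᵥ E.idCell v) (c.unit ≫ᵥ γ)
        (by simp [c.src_unit, c.tgt_counit, hv]) ≫ᵥ E.leftHom k := by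
    intro v γ hv
    rw [E.interchange _ _ _ _ (c.tgt_counit.trans c.src_unit.symm) (by simpa using hv.symm),
      E.comp_assoc, E.left_naturality, ← E.comp_assoc (E.hcomp _ _ _), c.hcomp_comp_leftHom,
      ← E.comp_assoc, E.right_inv_hom, E.one_comp]
  refine (key _ γ hs).trans (Eq.trans ?_ (key _ δ rfl).symm)
  simp only [h]

/-- The conjoint equation whiskered by `m` on the right; here the triangle identity is needed with
the associator inverted. -/
theorem counit_hcomp_whisker_unit {z : E.Obj} (m : E.Pro x z) :
    E.hcomp c.counit (E.hcomp c.unit (E.one m) (by simp [c.tgt_unit]))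
        (by simp [c.src_unit, c.tgt_counit]) ≫ᵥ E.leftHom (p ⊙ₚ m) =
      E.hcomp (E.one p) (E.leftHom m) (by simp) := by
  have h : E.hcomp (E.one p) (E.leftHom m) (by simp) =
      E.assocInv p (E.idPro x) m ≫ᵥ E.hcomp (E.rightHom p) (E.one m) (by simp) := by
    rw [← E.triangle, ← E.comp_assoc, E.assoc_inv_hom, E.one_comp]
  rw [leftHom_pcomp, ← E.comp_assoc, assocInv_naturality _ _ _
    (c.tgt_counit.trans c.src_unit.symm) (by simp [c.tgt_unit]), E.comp_assoc, ← E.interchange, h]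
  exact congrArg _ (hcomp_congr c.hcomp_comp_leftHom (E.one_comp _) _ _)

/-- Cells out of `p ⊙ m`, with `p` a conjoint, are determined by their composites with
`η ⊙ 1_m`. -/
theorem whisker_unit_cancel {z x' y' : E.Obj} {m : E.Pro x z} {k : E.Pro x' y'}
    {γ δ : E.Cell (p ⊙ₚ m) k} (hs : E.src γ = E.src δ)
    (h : E.hcomp c.unit (E.one m) (by simp [c.tgt_unit]) ≫ᵥ γ =
      E.hcomp c.unit (E.one m) (by simp [c.tgt_unit]) ≫ᵥ δ) : γ = δ := by
  have key : ∀ (v : y ⟶ x') (γ : E.Cell (p ⊙ₚ m) k) (hv : E.src γ = v),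
      γ = E.hcomp (E.one p) (E.leftInv m) (by simp) ≫ᵥ
        E.hcomp (c.counit ≫ᵥ E.idCell v) (E.hcomp c.unit (E.one m) (by simp [c.tgt_unit]) ≫ᵥ γ)
          (by simp [c.src_unit, c.tgt_counit, hv]) ≫ᵥ E.leftHom k := by
    intro v γ hv
    rw [E.interchange _ _ _ _ (by simp [c.src_unit, c.tgt_counit]) (by simpa using hv.symm),
      E.comp_assoc, E.left_naturality, ← E.comp_assoc (E.hcomp _ (E.hcomp _ _ _) _),
      c.counit_hcomp_whisker_unit, ← E.comp_assoc, ← E.interchange]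
    rw [hcomp_congr (E.one_comp _) (E.left_inv_hom m) _ (by simp), E.hcomp_one, E.one_comp]
  refine (key _ γ hs).trans (Eq.trans ?_ (key _ δ rfl).symm)
  simp only [h]

end

section Mates

variable {x y x' y' : E.Obj} {f : x ⟶ x'} {g : y ⟶ y'} {q : E.Pro x' x} {p : E.Pro y' y}
  (c : E.ConjointPair f q) (d : E.ConjointPair g p)

/-- The globular cell `q ⊙ m ⟶ n ⊙ p` corresponding to a cell `m ⟶ n` bounded by arrows with
conjoints `q` and `p`. -/
def mate {m : E.Pro x y} {n : E.Pro x' y'} (γ : E.Cell m n) (hs : E.src γ = f)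
    (ht : E.tgt γ = g) : q ⊙ₚ m ⟶ n ⊙ₚ p :=
  glob (E.rightInv (q ⊙ₚ m) ≫ᵥ
      E.hcomp (E.hcomp c.counit γ (c.tgt_counit.trans hs.symm)) d.unit
        (by simp [d.src_unit, ht]) ≫ᵥ
      E.hcomp (E.leftHom n) (E.one p) (by simp))
    (by simp [c.src_counit]) (by simp [d.tgt_unit])

/-- The left side of `γ` straightens by `η ⬝ ε = id_f`. The unitors compose in the order of the
identity lax protransformation, so this is external equivariance of `η` in the lax sense. -/
theorem unit_mate {m : E.Pro x y} {n : E.Pro x' y'} (γ : E.Cell m n) (hs : E.src γ = f)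
    (ht : E.tgt γ = g) :
    gcell ((leftU m).hom ≫ (rightU m).inv) ≫ᵥ E.hcomp γ d.unit (ht.trans d.src_unit.symm) =
      E.hcomp c.unit (E.one m) (by simp [c.tgt_unit]) ≫ᵥ gcell (mate c d γ hs ht) := by
  have h₁ : E.hcomp c.unit (E.one m) (by simp [c.tgt_unit]) ≫ᵥ
      E.hcomp c.counit γ (c.tgt_counit.trans hs.symm) ≫ᵥ E.leftHom n = E.leftHom m ≫ᵥ γ := by
    rw [← E.comp_assoc, ← E.interchange, hcomp_congr c.unit_comp_counit (E.one_comp γ) _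
      (by simpa using hs.symm), E.left_naturality]
  have h₂ : gcell (mate c d γ hs ht) = E.rightInv (q ⊙ₚ m) ≫ᵥ E.hcomp
      (E.hcomp c.counit γ (c.tgt_counit.trans hs.symm) ≫ᵥ E.leftHom n) d.unit
        (by simp [d.src_unit, ht]) := by
    refine congrArg _ ((E.interchange _ _ _ _ _ _).symm.trans ?_)
    exact hcomp_congr rfl (E.comp_one _) _ _
  rw [h₂, ← E.comp_assoc, rightInv_naturality (𝟙 y) _ (by simp), E.comp_assoc, ← E.interchange,
    gcell_comp, gcell_leftU_hom, gcell_rightU_inv, rightInv_naturality (𝟙 y) _ (by simp),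
    E.comp_assoc, ← E.interchange]
  exact congrArg _ (hcomp_congr h₁.symm rfl _ _)

theorem mate_counit {m : E.Pro x y} {n : E.Pro x' y'} (γ : E.Cell m n) (hs : E.src γ = f)
    (ht : E.tgt γ = g) :
    gcell (mate c d γ hs ht) ≫ᵥ E.hcomp (E.one n) d.counit (by simp [d.src_counit]) =
      E.hcomp c.counit γ (c.tgt_counit.trans hs.symm) ≫ᵥ
        gcell ((leftU n).hom ≫ (rightU n).inv) := by
  have h : gcell (mate c d γ hs ht) = E.rightInv (q ⊙ₚ m) ≫ᵥ
      E.hcomp (E.hcomp c.counit γ (c.tgt_counit.trans hs.symm)) d.unit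
        (by simp [d.src_unit, ht]) ≫ᵥ E.hcomp (E.leftHom n) (E.one p) (by simp) := rfl
  rw [h, E.comp_assoc, ← E.interchange, ← E.interchange, gcell_comp, gcell_leftU_hom,
    gcell_rightU_inv, ← E.comp_assoc, rightInv_naturality g _ (by simp [ht])]
  refine congrArg _ (hcomp_congr (by simp) ?_ _ _)
  rw [E.comp_one, d.unit_comp_counit]

end Mates

section ArrowMates

variable {x y x' y' : E.Obj} {f : x ⟶ x'} {g : y ⟶ y'} {q : E.Pro x' x} {p : E.Pro y' y}
  (c : E.ConjointPair f q) (d : E.ConjointPair g p)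
  {s : x ⟶ y} {t : x' ⟶ y'} (h : s ≫ g = f ≫ t)

/-- The cell between conjoints induced by a commutative square of arrows. -/
def arrowMate : E.Cell q p :=
  E.rightInv q ≫ᵥ E.hcomp (c.counit ≫ᵥ E.idCell t) (E.idCell s ≫ᵥ d.unit)
    (by simp [d.src_unit, c.tgt_counit, h]) ≫ᵥ E.leftHom p

theorem src_arrowMate : E.src (arrowMate c d h) = t := by
  simp [arrowMate, c.src_counit]

theorem tgt_arrowMate : E.tgt (arrowMate c d h) = s := by
  simp [arrowMate, d.tgt_unit]

theorem unit_arrowMate : c.unit ≫ᵥ arrowMate c d h = E.idCell s ≫ᵥ d.unit := by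
  unfold arrowMate
  rw [← E.comp_assoc, rightInv_naturality (𝟙 x) _ (by simp [c.tgt_unit]), E.comp_assoc,
    ← E.comp_assoc (E.hcomp _ _ _), ← E.interchange,
    hcomp_congr (γ' := E.idCell (s ≫ g)) (δ' := E.idCell s ≫ᵥ d.unit) _ _ _
      (by simp [d.src_unit]), E.left_naturality, ← leftInv_idPro, ← E.comp_assoc,
    E.left_inv_hom, E.one_comp]
  · rw [← E.comp_assoc, c.unit_comp_counit, ← E.idCell_comp, h]
  · simp

theorem arrowMate_counit : arrowMate c d h ≫ᵥ d.counit = c.counit ≫ᵥ E.idCell t := by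
  unfold arrowMate
  rw [E.comp_assoc, E.comp_assoc, ← E.left_naturality (𝟙 y') _ (by simp [d.src_counit]),
    ← E.comp_assoc (E.hcomp _ _ _), ← E.interchange,
    hcomp_congr (γ' := c.counit ≫ᵥ E.idCell t) (δ' := E.idCell (f ≫ t)) _ _ _
      (by simp [c.tgt_counit]), leftHom_idPro, E.right_naturality, ← E.comp_assoc,
    E.right_inv_hom, E.one_comp]
  · simp
  · rw [E.comp_assoc, d.unit_comp_counit, ← E.idCell_comp, h]

end ArrowMates

end ConjointPair

end DoubleCategory

end Dbl

/-! ### The protransformations assembled from componentwise companions and conjoints. -/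

namespace Dbl

open DoubleCategory

variable {D : DoubleCategory.{u₁, v₁, w₁, r₁}} {E : DoubleCategory.{u₂, v₂, w₂, r₂}}
  {F G : LaxFunctor D E}

theorem tcell_naturality (α : F ⟶ G) {x y x' y' : D.Obj} {m : D.Pro x y} {n : D.Pro x' y'}
    (γ : D.Cell m n) : F.cell γ ≫ᵥ tcell α n = tcell α m ≫ᵥ G.cell γ :=
  Transformation.cell_naturality α γ

theorem tcell_pcomp (α : F ⟶ G) {x y z : D.Obj} (m : D.Pro x y) (n : D.Pro y z) :
    gcell (F.laxComp m n) ≫ᵥ tcell α (m ⊙ₚ n) =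
      E.hcomp (tcell α m) (tcell α n) (by simp) ≫ᵥ gcell (G.laxComp m n) :=
  Transformation.cell_pcomp α m n

theorem tcell_idPro (α : F ⟶ G) (x : D.Obj) :
    gcell (F.laxId x) ≫ᵥ tcell α (D.idPro x) = E.idCell (tapp α x) ≫ᵥ gcell (G.laxId x) :=
  Transformation.cell_idPro α x

variable {α : F ⟶ G}

/-- The companion of a natural transformation whose components have companions. -/
def OplaxProtransformation.companion {p : ∀ x : D.Obj, E.Pro (F.base.obj x) (G.base.obj x)}
    (c : ∀ x, E.CompanionPair (tapp α x) (p x)) : OplaxProtransformation F G where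
  app := p
  arr {x y} f := (c x).arrowMate (c y) (tapp_naturality α f)
  src_arr f := CompanionPair.src_arrowMate _ _ _
  tgt_arr f := CompanionPair.tgt_arrowMate _ _ _
  nat {x y} m := (c x).mate (c y) (tcell α m) (src_tcell α m) (tgt_tcell α m)
  arr_id x := (c x).unit_cancel (by simp [CompanionPair.tgt_arrowMate]) (by
    simp [CompanionPair.unit_arrowMate])
  arr_comp {x y z} f g := (c x).unit_cancel (by simp [CompanionPair.tgt_arrowMate]) (by
    rw [CompanionPair.unit_arrowMate, ← E.comp_assoc, CompanionPair.unit_arrowMate, E.comp_assoc,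
      CompanionPair.unit_arrowMate, F.base.map_comp, E.idCell_comp, E.comp_assoc])
  nat_cell {x y x' y' m n} γ := (c y).whisker_unit_cancel (by
      simp [CompanionPair.tgt_arrowMate]) (by
    have hs := (c x).unit_arrowMate (c x') (tapp_naturality α (D.src γ))
    have ht := (c y).unit_arrowMate (c y') (tapp_naturality α (D.tgt γ))
    -- After composition with `1 ⊙ η` the mate of `α_m` becomes `η ⊙ α_m`. Equivariance of `η` and
    -- naturality of `α` at `γ` pull `F γ` to the front, past the unitors, and the mate of `α_n` is
    -- then restored.
    rw [← E.comp_assoc, ← CompanionPair.unit_mate, E.comp_assoc, ← E.interchange,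
      hcomp_congr hs (tcell_naturality α γ).symm _
        (by simp [(c x').tgt_unit, tapp_naturality]),
      E.interchange _ _ _ _ (by simp) (by simp [(c x').tgt_unit]), ← E.comp_assoc,
      oplaxUnit_square _ _ (F.base.map (D.tgt γ)) _ (by simp), E.comp_assoc,
      CompanionPair.unit_mate _ (c y'), ← E.comp_assoc, ← E.comp_assoc, ← E.interchange,
      ← E.interchange]
    exact congrArg (fun δ => δ ≫ᵥ _)
      (hcomp_congr ((E.comp_one _).trans (E.one_comp _).symm) ht.symm _ _))
  nat_pcomp {x y z} m n := gcell_ext <| (c z).whisker_unit_cancel (by simp) <| by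
    have hm := (c x).unit_mate (c y) (tcell α m) (by simp) (by simp)
    have hn := (c y).unit_mate (c z) (tcell α n) (by simp) (by simp)
    have hmn := (c x).unit_mate (c z) (tcell α (m ⊙ₚ n)) (by simp) (by simp)
    have h₁ : E.tgt (E.one (F.pro n)) = E.src (c z).unit := by simp [(c z).src_unit]
    have h₂ : E.tgt (E.one (F.pro m)) = E.src (c y).unit := by simp [(c y).src_unit]
    have h₃ : E.tgt (c y).unit = E.src (tcell α n) := by simp [(c y).tgt_unit]
    have h₄ : E.tgt (c x).unit = E.src (tcell α m) := by simp [(c x).tgt_unit]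
    -- After composition with `1 ⊙ η_z`, the left side becomes the left side of the same axiom for
    -- the identity protransformation of `F`, followed by `η_x ⊙ α_{m ⊙ n}`. That axiom is then
    -- applied, and the transfer back to the mates is done factor by factor.
    refine (square_comp (whiskerR_square (F.laxComp m n) (F.laxComp m n)
      (by simp [(c z).src_unit]) _ (by simp)) hmn).symm.trans ?_
    refine (congrArg (fun θ => gcell θ ≫ᵥ _)
      ((OplaxProtransformation.id F).nat_pcomp m n)).trans ?_
    -- The unit travels from `z` to `x`. Between consecutive squares stand the cells `1 ⊙ (1 ⊙
    -- η_z)`, `1 ⊙ (η_y ⊙ α_n)`, `(1 ⊙ η_y) ⊙ α_n`, `(η_x ⊙ α_m) ⊙ α_n`, `η_x ⊙ (α_m ⊙ α_n)`; the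
    -- last square is compatibility of `α` with the laxators.
    refine square_comp ((E.assoc_naturality _ _ _ (by simp) h₁).symm.trans
      (congrArg (fun δ => δ ≫ᵥ _) (hcomp_congr (E.hcomp_one _ _) rfl _ _))) ?_
    refine square_comp (whiskerL_square _ _ _
      ((E.tgt_one _).trans ((E.src_hcomp _ _ _).trans (c y).src_unit).symm) hn) ?_
    refine square_comp (assocInv_naturality _ _ _ h₂ h₃).symm ?_
    refine square_comp (whiskerR_square _ _ _
      ((E.tgt_hcomp _ _ _).trans ((tgt_tcell α m).trans (src_tcell α n).symm)) hm) ?_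
    refine square_comp (E.assoc_naturality _ _ _ h₄ (by simp)).symm ?_
    exact whiskerL_square _ _ _ _ (tcell_pcomp α m n)
  nat_idPro x := gcell_ext <| (c x).whisker_unit_cancel (by simp) <| by
    have hx := (c x).unit_mate (c x) (tcell α (D.idPro x)) (by simp) (by simp)
    refine (square_comp (whiskerR_square (F.laxId x) (F.laxId x)
      (by simp [(c x).src_unit]) _ (by simp)) hx).symm.trans ?_
    refine (congrArg (fun θ => gcell θ ≫ᵥ _)
      ((OplaxProtransformation.id F).nat_idPro x)).trans ?_
    -- The intermediate cells are `η_x` and `η_x ⊙ id_{α_x}`; the last square is compatibility of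
    -- `α` with the unit cells `F_x` and `G_x`.
    refine square_comp ((E.left_naturality (𝟙 _) (c x).unit (by simp [(c x).src_unit])).symm.trans
      (congrArg (fun δ => δ ≫ᵥ _) (hcomp_congr (E.idCell_id _) rfl _ _))) ?_
    refine square_comp (rightInv_naturality (tapp α x) _
      ((c x).tgt_unit.trans (E.src_idCell _).symm)).symm ?_
    exact whiskerL_square _ _ _ _ (tcell_idPro α x)

/-- The conjoint of a natural transformation whose components have conjoints. -/
def LaxProtransformation.conjoint {p : ∀ x : D.Obj, E.Pro (G.base.obj x) (F.base.obj x)}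
    (c : ∀ x, E.ConjointPair (tapp α x) (p x)) : LaxProtransformation G F where
  app := p
  arr {x y} f := (c x).arrowMate (c y) (tapp_naturality α f)
  src_arr f := ConjointPair.src_arrowMate _ _ _
  tgt_arr f := ConjointPair.tgt_arrowMate _ _ _
  nat {x y} m := (c x).mate (c y) (tcell α m) (src_tcell α m) (tgt_tcell α m)
  arr_id x := (c x).unit_cancel (by simp [ConjointPair.src_arrowMate]) (by
    simp [ConjointPair.unit_arrowMate])
  arr_comp {x y z} f g := (c x).unit_cancel (by simp [ConjointPair.src_arrowMate]) (by
    rw [ConjointPair.unit_arrowMate, ← E.comp_assoc, ConjointPair.unit_arrowMate, E.comp_assoc,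
      ConjointPair.unit_arrowMate, F.base.map_comp, E.idCell_comp, E.comp_assoc])
  nat_cell {x y x' y' m n} γ := (c x).whisker_unit_cancel (by
      simp [ConjointPair.src_arrowMate]) (by
    have hs := (c x).unit_arrowMate (c x') (tapp_naturality α (D.src γ))
    have ht := (c y).unit_arrowMate (c y') (tapp_naturality α (D.tgt γ))
    rw [← E.comp_assoc, ← ConjointPair.unit_mate, E.comp_assoc, ← E.interchange,
      hcomp_congr (tcell_naturality α γ).symm ht _
        (by simp [(c y').src_unit, tapp_naturality]),
      E.interchange _ _ _ _ (by simp) (by simp [(c y').src_unit]), ← E.comp_assoc,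
      laxUnit_square _ (F.base.map (D.src γ)) _ (by simp), E.comp_assoc,
      ConjointPair.unit_mate (c x'), ← E.comp_assoc, ← E.comp_assoc, ← E.interchange,
      ← E.interchange]
    exact congrArg (fun δ => δ ≫ᵥ _)
      (hcomp_congr hs.symm ((E.comp_one _).trans (E.one_comp _).symm) _ _))
  nat_pcomp {x y z} m n := gcell_ext <| (c x).whisker_unit_cancel (by simp) <| by
    have hm := (c x).unit_mate (c y) (tcell α m) (by simp) (by simp)
    have hn := (c y).unit_mate (c z) (tcell α n) (by simp) (by simp)
    have hmn := (c x).unit_mate (c z) (tcell α (m ⊙ₚ n)) (by simp) (by simp)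
    have h₁ : E.tgt (c x).unit = E.src (E.one (F.pro m)) := by simp [(c x).tgt_unit]
    have h₂ : E.tgt (c y).unit = E.src (E.one (F.pro n)) := by simp [(c y).tgt_unit]
    have h₃ : E.tgt (tcell α m) = E.src (c y).unit := by simp [(c y).src_unit]
    have h₄ : E.tgt (tcell α n) = E.src (c z).unit := by simp [(c z).src_unit]
    refine (square_comp (whiskerL_square (F.laxComp m n) (F.laxComp m n)
      (by simp [(c x).tgt_unit]) _ (by simp)) hmn).symm.trans ?_
    refine (congrArg (fun θ => gcell θ ≫ᵥ _)
      ((LaxProtransformation.id F).nat_pcomp m n)).trans ?_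
    -- The unit now travels from `x` to `z`, through `(η_x ⊙ 1) ⊙ 1`, `(α_m ⊙ η_y) ⊙ 1`, `α_m ⊙ (η_y
    -- ⊙ 1)`, `α_m ⊙ (α_n ⊙ η_z)` and `(α_m ⊙ α_n) ⊙ η_z`.
    refine square_comp ((assocInv_naturality _ _ _ h₁ (by simp)).symm.trans
      (congrArg (fun δ => δ ≫ᵥ _) (hcomp_congr rfl (E.hcomp_one _ _) _ _))) ?_
    refine square_comp (whiskerR_square _ _ _
      (((E.tgt_hcomp _ _ _).trans (c y).tgt_unit).trans (E.src_one _).symm) hm) ?_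
    refine square_comp (E.assoc_naturality _ _ _ h₃ h₂).symm ?_
    refine square_comp (whiskerL_square _ _ _
      ((tgt_tcell α m).trans ((E.src_hcomp _ _ _).trans (src_tcell α n)).symm) hn) ?_
    refine square_comp (assocInv_naturality _ _ _ (by simp) h₄).symm ?_
    exact whiskerR_square _ _ _ _ (tcell_pcomp α m n)
  nat_idPro x := gcell_ext <| (c x).whisker_unit_cancel (by simp) <| by
    have hx := (c x).unit_mate (c x) (tcell α (D.idPro x)) (by simp) (by simp)
    refine (square_comp (whiskerL_square (F.laxId x) (F.laxId x)
      (by simp [(c x).tgt_unit]) _ (by simp)) hx).symm.trans ?_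
    refine (congrArg (fun θ => gcell θ ≫ᵥ _)
      ((LaxProtransformation.id F).nat_idPro x)).trans ?_
    refine square_comp ((E.right_naturality (𝟙 _) (c x).unit (by simp [(c x).tgt_unit])).symm.trans
      (congrArg (fun δ => δ ≫ᵥ _) (hcomp_congr rfl (E.idCell_id _) _ _))) ?_
    refine square_comp (leftInv_naturality (tapp α x) _
      ((E.tgt_idCell _).trans (c x).src_unit.symm)).symm ?_
    exact whiskerR_square _ _ _ _ (tcell_idPro α x)

/-! ### Passage between componentwise and global companions and conjoints. -/

namespace DoubleCategory

/-- Componentwise companions assemble to a companion of a natural transformation. -/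
def CompanionPair.ofComponents {p : ∀ x : D.Obj, E.Pro (F.base.obj x) (G.base.obj x)}
    (c : ∀ x, E.CompanionPair (tapp α x) (p x)) :
    (LaxOpl D E).CompanionPair α (OplaxProtransformation.companion c) where
  unit :=
    { left := 𝟙 F
      right := α
      app x := (c x).unit
      src_app x := (c x).src_unit
      tgt_app x := (c x).tgt_unit
      app_arr f := (c _).unit_arrowMate (c _) (tapp_naturality α f)
      app_nat m := (c _).unit_mate (c _) (tcell α m) (src_tcell α m) (tgt_tcell α m) }
  src_unit := rfl
  tgt_unit := rfl
  counit :=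
    { left := α
      right := 𝟙 G
      app x := (c x).counit
      src_app x := (c x).src_counit
      tgt_app x := (c x).tgt_counit
      app_arr f := ((c _).arrowMate_counit (c _) (tapp_naturality α f)).symm
      app_nat m := (c _).mate_counit (c _) (tcell α m) (src_tcell α m) (tgt_tcell α m) }
  src_counit := rfl
  tgt_counit := rfl
  -- The bounding transformations are composites of identities, and at each object the equation is
  -- that of the chosen companion, since the unitors are componentwise.
  unit_hcomp_counit := OplaxModification.ext
    ((Category.id_comp _).trans (Category.id_comp _))
    ((Category.id_comp _).trans (Category.id_comp _))
    (funext fun x => (c x).unit_hcomp_counit)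
  unit_comp_counit := OplaxModification.ext (Category.id_comp _) (Category.comp_id _)
    (funext fun x => (c x).unit_comp_counit)

/-- The components of a companion of a natural transformation are companions. -/
def CompanionPair.component {τ : OplaxProtransformation F G}
    (c : (LaxOpl D E).CompanionPair α τ) (x : D.Obj) :
    E.CompanionPair (tapp α x) (τ.app x) where
  unit := OplaxModification.app c.unit x
  src_unit := (OplaxModification.src_app c.unit x).trans (congrArg (tapp · x) c.src_unit)
  tgt_unit := (OplaxModification.tgt_app c.unit x).trans (congrArg (tapp · x) c.tgt_unit)
  counit := OplaxModification.app c.counit x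
  src_counit := (OplaxModification.src_app c.counit x).trans (congrArg (tapp · x) c.src_counit)
  tgt_counit := (OplaxModification.tgt_app c.counit x).trans (congrArg (tapp · x) c.tgt_counit)
  -- Evaluation at `x` preserves both compositions and the unitors definitionally, so each equation
  -- is inherited directly.
  unit_hcomp_counit := congrArg (fun μ => OplaxModification.app μ x) c.unit_hcomp_counit
  unit_comp_counit := congrArg (fun μ => OplaxModification.app μ x) c.unit_comp_counit

/-- Componentwise conjoints assemble to a conjoint of a natural transformation. -/
def ConjointPair.ofComponents {p : ∀ x : D.Obj, E.Pro (G.base.obj x) (F.base.obj x)}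
    (c : ∀ x, E.ConjointPair (tapp α x) (p x)) :
    (LaxLax D E).ConjointPair α (LaxProtransformation.conjoint c) where
  unit :=
    { left := α
      right := 𝟙 F
      app x := (c x).unit
      src_app x := (c x).src_unit
      tgt_app x := (c x).tgt_unit
      app_arr f := (c _).unit_arrowMate (c _) (tapp_naturality α f)
      app_nat m := (c _).unit_mate (c _) (tcell α m) (src_tcell α m) (tgt_tcell α m) }
  src_unit := rfl
  tgt_unit := rfl
  counit :=
    { left := 𝟙 G
      right := α
      app x := (c x).counit
      src_app x := (c x).src_counit
      tgt_app x := (c x).tgt_counit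
      app_arr f := ((c _).arrowMate_counit (c _) (tapp_naturality α f)).symm
      app_nat m := (c _).mate_counit (c _) (tcell α m) (src_tcell α m) (tgt_tcell α m) }
  src_counit := rfl
  tgt_counit := rfl
  counit_hcomp_unit := LaxModification.ext
    ((Category.id_comp _).trans (Category.id_comp _))
    ((Category.id_comp _).trans (Category.id_comp _))
    (funext fun x => (c x).counit_hcomp_unit)
  unit_comp_counit := LaxModification.ext (Category.comp_id _) (Category.id_comp _)
    (funext fun x => (c x).unit_comp_counit)

/-- The components of a conjoint of a natural transformation are conjoints. -/
def ConjointPair.component {τ : LaxProtransformation G F}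
    (c : (LaxLax D E).ConjointPair α τ) (x : D.Obj) :
    E.ConjointPair (tapp α x) (τ.app x) where
  unit := LaxModification.app c.unit x
  src_unit := (LaxModification.src_app c.unit x).trans (congrArg (tapp · x) c.src_unit)
  tgt_unit := (LaxModification.tgt_app c.unit x).trans (congrArg (tapp · x) c.tgt_unit)
  counit := LaxModification.app c.counit x
  src_counit := (LaxModification.src_app c.counit x).trans (congrArg (tapp · x) c.src_counit)
  tgt_counit := (LaxModification.tgt_app c.counit x).trans (congrArg (tapp · x) c.tgt_counit)
  counit_hcomp_unit := congrArg (fun μ => LaxModification.app μ x) c.counit_hcomp_unit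
  unit_comp_counit := congrArg (fun μ => LaxModification.app μ x) c.unit_comp_counit

end DoubleCategory

end Dbl

/-! ### The main theorem. -/

theorem mainTheorem4
    (D : Dbl.DoubleCategory.{u₁, v₁, w₁, r₁}) (E : Dbl.DoubleCategory.{u₂, v₂, w₂, r₂})
    (F G : Dbl.LaxFunctor D E) (α : F ⟶ G) :
    ((∃ τ : Dbl.OplaxProtransformation F G, Nonempty ((Dbl.LaxOpl D E).CompanionPair α τ)) ↔
        ∀ x : D.Obj, E.HasCompanion (Dbl.tapp α x)) ∧
      ((∃ τ : Dbl.LaxProtransformation G F, Nonempty ((Dbl.LaxLax D E).ConjointPair α τ)) ↔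
        ∀ x : D.Obj, E.HasConjoint (Dbl.tapp α x)) := by
  refine ⟨⟨?_, fun h => ?_⟩, ⟨?_, fun h => ?_⟩⟩
  · rintro ⟨τ, ⟨c⟩⟩ x
    exact ⟨τ.app x, ⟨c.component x⟩⟩
  -- The companions are chosen independently at each object. No compatibility between the choices is
  -- needed, since the mates supply all the comparison cells.
  · choose p hp using h
    exact ⟨_, ⟨Dbl.DoubleCategory.CompanionPair.ofComponents fun x => (hp x).some⟩⟩
  · rintro ⟨τ, ⟨c⟩⟩ x
    exact ⟨τ.app x, ⟨c.component x⟩⟩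
  · choose p hp using h
    exact ⟨_, ⟨Dbl.DoubleCategory.ConjointPair.ofComponents fun x => (hp x).some⟩⟩
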